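/- Fix a field $k$. For a finite poset $\mathcal{P}$, let $\operatorname{mod}\mathcal{P}$ be the category of functors from $\mathcal{P}$ to finite-dimensional $k$-vector spaces ($\mathcal{P}$-modules), and let $\mathrm{K}_0^{\mathrm{sp}}(\mathcal{P})$ be its split Grothendieck group, i.e. the free abelian group on isomorphism classes $[M]$ modulo the relations $[M\oplus N]=[M]+[N]$. For an order-convex subset $S\subseteq\mathcal{P}$, let $\mathbb{I}_S$ be the module equal to $k$ on $S$ and to $0$ elsewhere, with identity maps between points of $S$. For a finite poset $\mathcal{X}$ with finitely many isomorphism classes of indecomposable modules, let $\operatorname{Ind}\mathcal{X}$ be a set of representatives of these classes, and let $\mathrm{Emb}_{\mathcal{X}}^{\mathcal{P}}$ be a set of representatives of the order-embeddings $\mathcal{X}\to\mathcal{P}$ (maps $f$ with $x\le x'\Leftrightarrow f(x)\le f(x')$) up to automorphisms of $\mathcal{X}$. For an order-embedding $f$, let $f^*:\operatorname{mod}\mathcal{P}\to\operatorname{mod}\mathcal{X}$ be the restriction functor, with left adjoint $f_!$ and right adjoint $f_*$. Let $\theta_f(U):f_!U\to f_*U$ be the morphism corresponding to $1_U$ under $\operatorname{Hom}_{\mathcal{P}}(f_!U,f_*U)\cong\operatorname{Hom}_{\mathcal{X}}(U,f^*f_*U)\cong\operatorname{End}_{\mathcal{X}}(U)$,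 and let $\Theta_f(U)=\operatorname{Im}\theta_f(U)$ be the intermediate extension. The invariant $$\mathbf{mult}_{\mathcal{X},\mathcal{P}}:\mathrm{K}_0^{\mathrm{sp}}(\mathcal{P})\to\mathbb{Z}^{\mathrm{Emb}_{\mathcal{X}}^{\mathcal{P}}\times\operatorname{Ind}\mathcal{X}}$$ is the homomorphism whose value on $[M]$ at $(f,U)$ is the multiplicity of $U$ in a decomposition of $f^*M$ into indecomposables. A basis of a homomorphism $\Psi:\mathrm{K}_0^{\mathrm{sp}}(\mathcal{P})\to\mathbb{Z}^J$ with finitely generated image is a set $\mathcal{B}$ of indecomposable $\mathcal{P}$-modules such that $\Psi$ restricts to an isomorphism from the free abelian subgroup of $\mathrm{K}_0^{\mathrm{sp}}(\mathcal{P})$ generated by the classes $[U]$, $U\in\mathcal{B}$, onto $\operatorname{Im}\Psi$. **Theorem.** Let $\mathcal{P}$ be a finite connected poset, and let $\mathcal{X}$ be one of the posets on $\{1,2,3\}$ given by $\mathcal{X}'_3$: $1<2$, $1<3$ (with $2,3$ incomparable), or $\mathcal{X}''_3$: $1<3$, $2<3$ (with $1,2$ incomparable). Assume that for all $a<b$ in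 $\mathcal{P}$ there is $f\in\mathrm{Emb}_{\mathcal{X}}^{\mathcal{P}}$ with $\{a,b\}\subseteq\operatorname{Im} f$. Then the set $$\mathcal{R}=\{\Theta_f(U)\mid f\in\mathrm{Emb}_{\mathcal{X}}^{\mathcal{P}},\ U\in\operatorname{Ind}\mathcal{X}\}$$ is a basis of $\mathbf{mult}_{\mathcal{X},\mathcal{P}}$. Moreover, if $\mathcal{P}$ has at least two elements, then a $\mathcal{P}$-module is isomorphic to a member of $\mathcal{R}$ if and only if it is simple, or isomorphic to a rectangle module $\mathbb{I}_{[a,b]}$ with $a<b$, or isomorphic to a generalized rectangle module: $\mathbb{I}_{[f(1),f(2)]\cup[f(1),f(3)]}$ with $f\in\mathrm{Emb}_{\mathcal{X}}^{\mathcal{P}}$ if $\mathcal{X}=\mathcal{X}'_3$, and $\mathbb{I}_{[f(1),f(3)]\cup[f(2),f(3)]}$ with $f\in\mathrm{Emb}_{\mathcal{X}}^{\mathcal{P}}$ if $\mathcal{X}=\mathcal{X}''_3$. -/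

import Mathlib

open CategoryTheory CategoryTheory.Limits

universe v u w

noncomputable section

namespace PosetRep

/-! ### The two three-point posets -/

/-- The poset `X'_3` with one source `one` and two sinks `two`, `three`:
the strict relations are `one < two` and `one < three`. -/
inductive XPrime : Type
  | one
  | two
  | three

/-- The poset `X''_3` with two sources `one`, `two` and one sink `three`:
the strict relations are `one < three` and `two < three`. -/
inductive XDoublePrime : Type
  | one
  | two
  | three

instance : PartialOrder XPrime where
  le x y := x = y ∨ x = .one
  lt x y := x ≠ y ∧ x = .one
  le_refl x := Or.inl rfl
  le_trans x y z hxy hyz := by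
    cases x <;> cases y <;> cases z <;> simp_all
  lt_iff_le_not_ge x y := by
    cases x <;> cases y <;> simp
  le_antisymm x y hxy hyx := by
    cases x <;> cases y <;> simp_all

instance : PartialOrder XDoublePrime where
  le x y := x = y ∨ y = .three
  lt x y := x ≠ y ∧ y = .three
  le_refl x := Or.inl rfl
  le_trans x y z hxy hyz := by
    cases x <;> cases y <;> cases z <;> simp_all
  lt_iff_le_not_ge x y := by
    cases x <;> cases y <;> simp
  le_antisymm x y hxy hyx := by
    cases x <;> cases y <;> simp_all

instance : Finite XPrime :=
  Finite.of_surjective (fun i : Fin 3 => match i with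
    | 0 => XPrime.one
    | 1 => XPrime.two
    | 2 => XPrime.three) (by
      intro x
      cases x
      exacts [⟨0, rfl⟩, ⟨1, rfl⟩, ⟨2, rfl⟩])

instance : Finite XDoublePrime :=
  Finite.of_surjective (fun i : Fin 3 => match i with
    | 0 => XDoublePrime.one
    | 1 => XDoublePrime.two
    | 2 => XDoublePrime.three) (by
      intro x
      cases x
      exacts [⟨0, rfl⟩, ⟨1, rfl⟩, ⟨2, rfl⟩])

/-! ### The split Grothendieck group and bases of invariants

These are stated for an arbitrary category `C` with zero morphisms and binary biproducts. -/

section SplitGrothendieck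

variable (C : Type u) [Category.{v} C] [HasZeroMorphisms C] [HasBinaryBiproducts C]

/-- The free abelian group on the isomorphism classes of objects of `C`. -/
abbrev FreeOnIsoClasses : Type u :=
  FreeAbelianGroup (Quotient (isIsomorphicSetoid C))

variable {C} in
/-- The generator given by the isomorphism class of `M`. -/
def isoClassGen (M : C) : FreeOnIsoClasses C :=
  FreeAbelianGroup.of (Quotient.mk (isIsomorphicSetoid C) M)

/-- The subgroup generated by the relations `[M ⊞ N] = [M] + [N]`. -/
def splitRelations : AddSubgroup (FreeOnIsoClasses C) :=
  AddSubgroup.closure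
    {x | ∃ M N : C, x = isoClassGen (M ⊞ N) - (isoClassGen M + isoClassGen N)}

/-- The split Grothendieck group `K₀ˢᵖ` of `C`. -/
abbrev K0sp : Type u := FreeOnIsoClasses C ⧸ splitRelations C

variable {C}

/-- The class `[M]` of an object in the split Grothendieck group. -/
def K0sp.cls (M : C) : K0sp C := QuotientAddGroup.mk (isoClassGen M)

/-- A homomorphism out of the split Grothendieck group is determined by its values
on the classes of objects. -/
theorem K0sp.hom_ext {A : Type w} [AddCommGroup A] {Φ Ψ : K0sp C →+ A}
    (h : ∀ M : C, Φ (K0sp.cls M) = Ψ (K0sp.cls M)) : Φ = Ψ := by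
  apply QuotientAddGroup.addMonoidHom_ext
  apply FreeAbelianGroup.lift_ext
  intro q
  induction q using Quotient.inductionOn with
  | h M => exact h M

/-- A set `B` of objects is a basis of the invariant `Ψ : K₀ˢᵖ → ℤ^J`: the invariant `Ψ` is finite
(its image is finitely generated), `B` consists of indecomposable objects, the classes of the
objects of `B` freely generate a subgroup of `K₀ˢᵖ`, and `Ψ` restricts to an isomorphism from
this subgroup onto the image of `Ψ`. -/
structure IsBasisOfInvariant {J : Type w} (Ψ : K0sp C →+ (J → ℤ)) (B : Set C) : Prop where
  finite : Ψ.range.FG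
  indecomposable : ∀ U ∈ B, Indecomposable U
  free : LinearIndependent ℤ (fun c : (K0sp.cls '' B : Set (K0sp C)) => (c : K0sp C))
  bijOn : Set.BijOn Ψ (AddSubgroup.closure (K0sp.cls '' B) : Set (K0sp C)) (Ψ.range : Set (J → ℤ))

variable (C) in
/-- `I` is a set of representatives of the isomorphism classes of indecomposable objects. -/
def IsIndRepresentatives (I : Set C) : Prop :=
  (∀ U ∈ I, Indecomposable U) ∧
    ∀ V : C, Indecomposable V → ∃! U : C, U ∈ I ∧ Nonempty (V ≅ U)

end SplitGrothendieck

/-! ### Modules over posets -/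

/-- The category of finite-dimensional `P`-modules over `k`: functors from the poset `P`
to finite-dimensional `k`-vector spaces. -/
abbrev PMod (k : Type v) [Field k] (P : Type u) [PartialOrder P] : Type (max u (v + 1)) :=
  P ⥤ FGModuleCat.{v} k

section Modules

variable (k : Type v) [Field k]

instance (P : Type u) [PartialOrder P] : HasFiniteBiproducts (PMod k P) :=
  Abelian.hasFiniteBiproducts

section Interval

variable {P : Type u} [PartialOrder P]

/-- The space of the module `𝕀_S` at `p`: all of `k` if `p ∈ S`, and zero otherwise. -/
def intervalSpace (S : Set P) (p : P) : Submodule k k where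
  carrier := {x | p ∉ S → x = 0}
  add_mem' hx hy hp := by rw [hx hp, hy hp, add_zero]
  zero_mem' _ := rfl
  smul_mem' c x hx hp := by rw [hx hp, smul_zero]

open Classical in
/-- The map of the module `𝕀_S` from the space at `p` to the space at `q`: it sends `x ∈ k` to `x`
if `q ∈ S` and to zero otherwise. -/
def intervalMap (S : Set P) (p q : P) : intervalSpace k S p →ₗ[k] intervalSpace k S q where
  toFun x := ⟨if q ∈ S then (x : k) else 0, fun hq => if_neg hq⟩
  map_add' x y := by ext; dsimp; split_ifs <;> simp
  map_smul' c x := by ext; dsimp; split_ifs <;> simp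

open Classical in
/-- For an order-convex subset `S` of `P`, the module `𝕀_S` is `k` at each point of `S` and zero
at all other points; all maps between points of `S` are identities and all other maps are zero. -/
def intervalModule (S : Set P) [hS : S.OrdConnected] : PMod k P where
  obj p := FGModuleCat.of k (intervalSpace k S p)
  map {p q} _ := FGModuleCat.ofHom (intervalMap k S p q)
  map_id p := by
    apply FGModuleCat.hom_ext
    apply LinearMap.ext
    intro x
    apply Subtype.ext
    change (if p ∈ S then (x : k) else 0) = x
    split_ifs with hp
    · rfl
    · exact (x.2 hp).symm
  map_comp {p q r} f g := by
    apply FGModuleCat.hom_ext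
    apply LinearMap.ext
    intro x
    apply Subtype.ext
    change (if r ∈ S then (x : k) else 0) = if r ∈ S then (if q ∈ S then (x : k) else 0) else 0
    split_ifs with hr hq
    · rfl
    · exact x.2 fun hp => hq (hS.out hp hr ⟨leOfHom f, leOfHom g⟩)
    · rfl

instance ordConnected_union_left (a b c : P) :
    (Set.Icc a b ∪ Set.Icc a c : Set P).OrdConnected := by
  refine ⟨?_⟩
  rintro x hx y (hy | hy) z ⟨hxz, hzy⟩
  · exact Or.inl ⟨(hx.elim (·.1) (·.1)).trans hxz, hzy.trans hy.2⟩
  · exact Or.inr ⟨(hx.elim (·.1) (·.1)).trans hxz, hzy.trans hy.2⟩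

instance ordConnected_union_right (a b c : P) :
    (Set.Icc a c ∪ Set.Icc b c : Set P).OrdConnected := by
  refine ⟨?_⟩
  rintro x (hx | hx) y hy z ⟨hxz, hzy⟩
  · exact Or.inl ⟨hx.1.trans hxz, hzy.trans (hy.elim (·.2) (·.2))⟩
  · exact Or.inr ⟨hx.1.trans hxz, hzy.trans (hy.elim (·.2) (·.2))⟩

end Interval

/-! ### Restriction along order-embeddings and the intermediate extension -/

section Embeddings

variable {X : Type w} [PartialOrder X] {P : Type u} [PartialOrder P]

/-- The functor between poset categories given by an order-embedding. -/
abbrev embFunctor (f : X ↪o P) : X ⥤ P := f.monotone.functor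

instance (f : X ↪o P) : (embFunctor f).Full where
  map_surjective g := ⟨homOfLE (f.le_iff_le.1 (leOfHom g)), rfl⟩

/-- The restriction functor `f^*`. -/
abbrev restrict (f : X ↪o P) : PMod k P ⥤ PMod k X :=
  (Functor.whiskeringLeft X P (FGModuleCat.{v} k)).obj (embFunctor f)

/-- `E` is a set of representatives of the order-embeddings `X → P` up to automorphisms of `X`. -/
def IsEmbRepresentatives (E : Set (X ↪o P)) : Prop :=
  ∀ g : X ↪o P, ∃! f : X ↪o P, f ∈ E ∧ ∃ σ : X ≃o X, ∀ x, g x = f (σ x)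

section KanExtensions

variable [Finite X]

instance (f : X ↪o P) (p : P) :
    HasColimitsOfShape (CostructuredArrow (embFunctor f) p) (FGModuleCat.{v} k) := by
  let G : {x : X // f x ≤ p} ⥤ CostructuredArrow (embFunctor f) p :=
    { obj := fun x => CostructuredArrow.mk (Y := x.1) (homOfLE x.2)
      map := fun {x y} g => CostructuredArrow.homMk (homOfLE (leOfHom g)) }
  have : G.Faithful := ⟨fun _ => Subsingleton.elim _ _⟩
  have : G.Full := ⟨fun {x y} g => ⟨homOfLE (leOfHom g.left),
    CostructuredArrow.hom_ext _ _ (Subsingleton.elim _ _)⟩⟩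
  have : G.EssSurj := ⟨fun Y => ⟨⟨Y.left, leOfHom Y.hom⟩,
    ⟨CostructuredArrow.isoMk (Iso.refl _)⟩⟩⟩
  have : G.IsEquivalence := {}
  let _ : Fintype {x : X // f x ≤ p} := Fintype.ofFinite _
  exact hasColimitsOfShape_of_equivalence G.asEquivalence

instance (f : X ↪o P) (p : P) :
    HasLimitsOfShape (StructuredArrow p (embFunctor f)) (FGModuleCat.{v} k) := by
  let G : {x : X // p ≤ f x} ⥤ StructuredArrow p (embFunctor f) :=
    { obj := fun x => StructuredArrow.mk (Y := x.1) (homOfLE x.2)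
      map := fun {x y} g => StructuredArrow.homMk (homOfLE (leOfHom g)) }
  have : G.Faithful := ⟨fun _ => Subsingleton.elim _ _⟩
  have : G.Full := ⟨fun {x y} g => ⟨homOfLE (leOfHom g.right),
    StructuredArrow.hom_ext _ _ (Subsingleton.elim _ _)⟩⟩
  have : G.EssSurj := ⟨fun Y => ⟨⟨Y.right, leOfHom Y.hom⟩,
    ⟨StructuredArrow.isoMk (Iso.refl _)⟩⟩⟩
  have : G.IsEquivalence := {}
  let _ : Fintype {x : X // p ≤ f x} := Fintype.ofFinite _
  exact hasLimitsOfShape_of_equivalence G.asEquivalence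

/-- The induction functor `f_!`, left adjoint to `f^*`. -/
abbrev induction (f : X ↪o P) : PMod k X ⥤ PMod k P := (embFunctor f).lan

/-- The coinduction functor `f_*`, right adjoint to `f^*`. -/
abbrev coinduction (f : X ↪o P) : PMod k X ⥤ PMod k P := (embFunctor f).ran

/-- The adjunction between `f_!` and `f^*`. -/
abbrev inductionAdj (f : X ↪o P) : induction k f ⊣ restrict k f :=
  (embFunctor f).lanAdjunction (FGModuleCat.{v} k)

/-- The adjunction between `f^*` and `f_*`. -/
abbrev coinductionAdj (f : X ↪o P) : restrict k f ⊣ coinduction k f :=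
  (embFunctor f).ranAdjunction (FGModuleCat.{v} k)

variable {k}

/-- The natural map `θ_f U : f_! U ⟶ f_* U` corresponding to the identity of `U` under
`Hom(f_! U, f_* U) ≅ Hom(U, f^* f_* U) ≅ Hom(U, U)`, where the second isomorphism is induced by
the counit `f^* f_* U ≅ U`. -/
def theta (f : X ↪o P) (U : PMod k X) : (induction k f).obj U ⟶ (coinduction k f).obj U :=
  ((inductionAdj k f).homEquiv U ((coinduction k f).obj U)).symm
    (inv ((coinductionAdj k f).counit.app U))

/-- The intermediate extension `Θ_f U`, the image of `θ_f U`. -/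
def Theta (f : X ↪o P) (U : PMod k X) : PMod k P := image (theta f U)

/-- The set `{Θ_f U | f ∈ E, U ∈ I}` of intermediate extensions. -/
def intermediateExtensions (E : Set (X ↪o P)) (I : Set (PMod k X)) : Set (PMod k P) :=
  {N | ∃ f ∈ E, ∃ U ∈ I, N = Theta f U}

end KanExtensions

/-! ### The multiplicity invariant -/

variable {k}

/-- The finite family `V` is a decomposition of `N` as a direct sum of indecomposables. -/
def IsDecomposition (N : PMod k X) {n : ℕ} (V : Fin n → PMod k X) : Prop :=
  (∀ i, Indecomposable (V i)) ∧ Nonempty (N ≅ ⨁ V)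

/-- `m` is the multiplicity of `U` in `N`: the module `N` has a decomposition into
indecomposables, and in every such decomposition exactly `m` summands are isomorphic to `U`. -/
def IsMultiplicity (U N : PMod k X) (m : ℕ) : Prop :=
  (∃ (n : ℕ) (V : Fin n → PMod k X), IsDecomposition N V) ∧
    ∀ (n : ℕ) (V : Fin n → PMod k X), IsDecomposition N V →
      Nat.card {i : Fin n // Nonempty (V i ≅ U)} = m

/-- `Ψ` is the multiplicity invariant `mult_{X,P}`, the homomorphism `K₀ˢᵖ(P) → ℤ^(E × I)` whose
value on `[M]` at `(f, U)` is the multiplicity of `U` in `f^* M`. -/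
def IsMultInvariant (E : Set (X ↪o P)) (I : Set (PMod k X))
    (Ψ : K0sp (PMod k P) →+ (E × I → ℤ)) : Prop :=
  ∀ (M : PMod k P) (f : E) (U : I), ∃ m : ℕ,
    IsMultiplicity U.1 ((restrict k f.1).obj M) m ∧ Ψ (K0sp.cls M) (f, U) = m

/-- There is at most one multiplicity invariant. -/
theorem IsMultInvariant.unique {E : Set (X ↪o P)} {I : Set (PMod k X)}
    {Φ Ψ : K0sp (PMod k P) →+ (E × I → ℤ)}
    (hΦ : IsMultInvariant E I Φ) (hΨ : IsMultInvariant E I Ψ) : Φ = Ψ := by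
  apply K0sp.hom_ext
  intro M
  funext ⟨f, U⟩
  obtain ⟨m, hm, h₁⟩ := hΦ M f U
  obtain ⟨m', hm', h₂⟩ := hΨ M f U
  obtain ⟨n, V, hV⟩ := hm.1
  rw [h₁, h₂, ← hm.2 n V hV, ← hm'.2 n V hV]

end Embeddings

end Modules

end PosetRep

end

open PosetRep

/-! Every indecomposable module over the three-point poset is an interval module `𝕀_S`, where `S`
has a least element (for `XPrime`) or a greatest element (for `XDoublePrime`). This is linear
algebra for two maps with a common source or target: each nonzero module has such an interval module
as a retract (`XPrime.exists_retract`, `XDoublePrime.exists_retract`).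

Multiplicities are traded for generalized ranks. If `S` has least element `a`, the rank of `M` over
`S` is the dimension of `M(a)` modulo the sum of the kernels of the maps from `a` to points of `S`;
dually, for a greatest element, it is the dimension of the intersection of the images in `M(a)`.
Ranks are additive and take the value 1 on `𝕀_T` if `S ⊆ T` and 0 otherwise. So ranks and
multiplicities are related by the zeta matrix of an inclusion order, which is invertible over the
integers (`exists_inverse_zeta`).

The rank of `f^* M` over `S` equals the rank of `M` over the convex hull of `f(S)`
(`leastRank_restrict`, `greatestRank_restrict`), so it depends only on that hull. The multiplicity
invariant therefore has the same kernel as the family of ranks over all hulls. On the interval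
modules of the hulls this family is again a zeta matrix, so these modules form a basis
(`zeta_basis`). They are exactly the intermediate extensions, since `Θ_f(𝕀_S)` is the interval
module of the hull (`nonempty_hull_iso_Theta`).

For the explicit description, the sets `S` are the singletons, the pairs `{a, b}` with `a < b` and
the whole poset. Their hulls give the simple modules, the rectangles and the generalized rectangles
(`exists_iso_hull_iff`). -/

noncomputable section

namespace PosetRep

/-! ### Additive invariants -/

section AdditiveInvariants

variable {C : Type u} [Category.{v} C]

/-- A function on objects that is invariant under isomorphism and additive on biproducts. -/
structure IsAdditiveInvariant [HasZeroMorphisms C] [HasBinaryBiproducts C]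
    {A : Type*} [AddCommGroup A] (r : C → A) : Prop where
  iso : ∀ {M N : C}, Nonempty (M ≅ N) → r M = r N
  biprod : ∀ M N : C, r (M ⊞ N) = r M + r N

section

variable [HasZeroMorphisms C] [HasBinaryBiproducts C] {A : Type*} [AddCommGroup A]

/-- The homomorphism on the split Grothendieck group given by an additive invariant. -/
def K0sp.lift (r : C → A) (h : IsAdditiveInvariant r) : K0sp C →+ A :=
  QuotientAddGroup.lift (splitRelations C)
    (FreeAbelianGroup.lift (Quotient.lift r fun _ _ e => h.iso e)) (by
      rw [splitRelations, AddSubgroup.closure_le]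
      rintro _ ⟨M, N, rfl⟩
      have (L : C) : FreeAbelianGroup.lift (Quotient.lift r fun _ _ e => h.iso e)
          (isoClassGen L) = r L := FreeAbelianGroup.lift_apply_of _ _
      simp [this, h.biprod])

theorem K0sp.lift_cls (r : C → A) (h : IsAdditiveInvariant r) (M : C) :
    K0sp.lift r h (K0sp.cls M) = r M :=
  FreeAbelianGroup.lift_apply_of _ _

/-- Classes of objects determine homomorphisms, so a linear relation between invariants of objects
extends to the whole group. -/
theorem K0sp.eq_sum {ι : Type*} (s : Finset ι) (c : ι → ℤ) (Φ : K0sp C →+ ℤ)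
    (Φ' : ι → K0sp C →+ ℤ)
    (h : ∀ M : C, Φ (K0sp.cls M) = ∑ i ∈ s, c i * Φ' i (K0sp.cls M)) (x : K0sp C) :
    Φ x = ∑ i ∈ s, c i * Φ' i x := by
  have : Φ = ∑ i ∈ s, c i • Φ' i := K0sp.hom_ext fun M => by simp [h]
  simp [this]

theorem K0sp.cls_eq_of_iso {M N : C} (e : Nonempty (M ≅ N)) : K0sp.cls M = K0sp.cls N :=
  congrArg (fun q => QuotientAddGroup.mk (FreeAbelianGroup.of q))
    (Quotient.sound (s := isIsomorphicSetoid C) e)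

theorem IsAdditiveInvariant.of_isZero {r : C → A} (h : IsAdditiveInvariant r) {Z : C}
    (hZ : IsZero Z) : r Z = 0 := by
  have e : Z ⊞ Z ≅ Z := ((biprod_isZero_iff Z Z).2 ⟨hZ, hZ⟩).iso hZ
  have h1 := h.biprod Z Z
  rw [h.iso ⟨e⟩] at h1
  simpa using h1

theorem IsAdditiveInvariant.sum {ι : Type*} (s : Finset ι) (c : ι → ℤ) {r : ι → C → ℤ}
    (h : ∀ i ∈ s, IsAdditiveInvariant (r i)) :
    IsAdditiveInvariant fun M => ∑ i ∈ s, c i * r i M where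
  iso e := Finset.sum_congr rfl fun i hi => by rw [(h i hi).iso e]
  biprod M N := by
    rw [← Finset.sum_add_distrib]
    exact Finset.sum_congr rfl fun i hi => by rw [(h i hi).biprod, mul_add]

end

section Preadditive

variable [Preadditive C] [HasBinaryBiproducts C]

section

variable [HasFiniteBiproducts C]

/-- A biproduct over `Fin (n + 1)` splits off its first summand. -/
def biproductFinSucc {n : ℕ} (V : Fin (n + 1) → C) :
    ⨁ V ≅ V 0 ⊞ ⨁ fun i : Fin n => V i.succ where
  hom := biprod.lift (biproduct.π V 0) (biproduct.lift fun i => biproduct.π V i.succ)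
  inv := biprod.desc (biproduct.ι V 0) (biproduct.desc fun i => biproduct.ι V i.succ)
  hom_inv_id := by
    rw [biprod.lift_desc, biproduct.lift_desc, ← biproduct.total, Fin.sum_univ_succ]
  inv_hom_id := by
    apply biprod.hom_ext'
    · apply biprod.hom_ext
      · simp
      · ext j
        simp [biproduct.ι_π_ne _ (Fin.succ_ne_zero j).symm]
    · refine biproduct.hom_ext' _ _ fun i => ?_
      apply biprod.hom_ext
      · simp [biproduct.ι_π_ne _ (Fin.succ_ne_zero i)]
      · ext j
        by_cases h : i = j
        · subst h; simp
        · have h' : i.succ ≠ j.succ := fun e => h (Fin.succ_injective _ e)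
          simp [biproduct.ι_π_ne _ h', biproduct.ι_π_ne _ h]

theorem IsAdditiveInvariant.biproduct {A : Type*} [AddCommGroup A] {r : C → A}
    (h : IsAdditiveInvariant r) {n : ℕ} (V : Fin n → C) : r (⨁ V) = ∑ i, r (V i) := by
  induction n with
  | zero =>
    rw [Fin.sum_univ_zero]
    refine h.of_isZero ((IsZero.iff_id_eq_zero _).2 ?_)
    ext i
    exact i.elim0
  | succ n ih => rw [h.iso ⟨biproductFinSucc V⟩, h.biprod, ih, Fin.sum_univ_succ]

end

theorem isAdditiveInvariant_finrank {k : Type w} [Field k] (F : C ⥤ ModuleCat.{w} k) [F.Additive]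
    (hF : ∀ M, Module.Finite k (F.obj M)) :
    IsAdditiveInvariant fun M => (Module.finrank k (F.obj M) : ℤ) where
  iso := fun ⟨e⟩ => congrArg _ (F.mapIso e).toLinearEquiv.finrank_eq
  biprod M N := by
    have := preservesBinaryBiproducts_of_preservesBiproducts F
    have e := (F.mapBiprod M N ≪≫ ModuleCat.biprodIsoProd _ _).toLinearEquiv
    rw [e.finrank_eq, ← Nat.cast_add]
    congr 1
    exact Module.finrank_prod

end Preadditive

/-- The complement is the cokernel of the split monomorphism. -/
theorem nonempty_iso_biprod_of_retract [Abelian C] {A N : C} (h : Retract A N) :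
    ∃ Q : C, Nonempty (N ≅ A ⊞ Q) := by
  have : IsSplitMono h.i := ⟨⟨⟨h.r, h.retract⟩⟩⟩
  exact ⟨_, ⟨biprod.uniqueUpToIso _ _
    (isBilimitBinaryBiconeOfIsSplitMonoOfCokernel (cokernelIsCokernel h.i))⟩⟩

end AdditiveInvariants

/-! ### Inverting the zeta matrix of a finite poset -/

open Classical in
-- Ordered along a linear extension, the zeta matrix is upper triangular with ones on the diagonal.
-- Its determinant is 1, so its inverse is integral.
theorem exists_inverse_zeta (T : Type u) [PartialOrder T] [Fintype T] :
    ∃ B : T → T → ℤ,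
      (∀ s t, ∑ x, B s x * (if x ≤ t then 1 else 0) = if s = t then 1 else 0) ∧
      (∀ s t, ∑ x, (if s ≤ x then 1 else 0) * B x t = if s = t then 1 else 0) := by
  let Z : Matrix T T ℤ := Matrix.of fun s t => if s ≤ t then 1 else 0
  let e : LinearExtension T ≃ T := Equiv.refl T
  have : Fintype (LinearExtension T) := ‹Fintype T›
  have hZ : Z.det = 1 := by
    rw [← Matrix.det_submatrix_equiv_self e Z, Matrix.det_of_isUpperTriangular]
    · exact Finset.prod_eq_one fun i _ => if_pos (le_refl (e i))
    · intro i j hij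
      exact if_neg fun h : e i ≤ e j => absurd (toLinearExtension.monotone h) (not_le.2 hij)
  have hu : IsUnit Z.det := by rw [hZ]; exact isUnit_one
  refine ⟨(Z⁻¹ : Matrix T T ℤ), fun s t => ?_, fun s t => ?_⟩
  · exact (congrFun (congrFun (Matrix.nonsing_inv_mul Z hu) s) t).trans (Matrix.one_apply)
  · exact (congrFun (congrFun (Matrix.mul_nonsing_inv Z hu) s) t).trans (Matrix.one_apply)

open Classical in
/-- If finitely many functionals `μ` take on a family `e` the values of the zeta matrix of a
poset, then modulo the common kernel of the functionals, each element is a unique combination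
of the members of the family. -/
theorem zeta_basis {T : Type u} [PartialOrder T] [Finite T] {K : Type w} [AddCommGroup K]
    (e : T → K) (μ : T → K →+ ℤ) (h : ∀ s t, μ s (e t) = if s ≤ t then 1 else 0) :
    LinearIndependent ℤ e ∧
      (∀ y ∈ AddSubgroup.closure (Set.range e), (∀ s, μ s y = 0) → y = 0) ∧
      ∀ x, ∃ y ∈ AddSubgroup.closure (Set.range e), ∀ s, μ s y = μ s x := by
  have := Fintype.ofFinite T
  obtain ⟨B, hB1, hB2⟩ := exists_inverse_zeta T
  have hμ (c : T → ℤ) (s : T) : μ s (∑ t, c t • e t) = ∑ t, (if s ≤ t then 1 else 0) * c t := by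
    simp [h, mul_comm]
  -- The values of the functionals on a combination are the zeta matrix applied to its coefficients.
  -- The left inverse recovers the coefficients, which gives both independence and injectivity.
  have key (c : T → ℤ) (hc : ∀ s, μ s (∑ t, c t • e t) = 0) : c = 0 := by
    funext s
    have : ∑ x, B s x * ∑ t, (if x ≤ t then 1 else 0) * c t = c s := by
      simp_rw [Finset.mul_sum, ← mul_assoc]
      rw [Finset.sum_comm]
      simp_rw [← Finset.sum_mul, hB1]
      simp
    rw [← this]
    exact Finset.sum_eq_zero fun x _ => by rw [← hμ, hc, mul_zero]
  -- The coefficients of `y` are the inverse matrix applied to the values of the functionals at `x`;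
  -- here the right inverse identity is used.
  refine ⟨?_, fun y hy h0 => ?_, fun x => ⟨∑ t, (∑ r, B t r * μ r x) • e t, ?_, fun s => ?_⟩⟩
  · rw [Fintype.linearIndependent_iff]
    intro c hc
    exact congrFun (key c fun s => by rw [hc, map_zero])
  · rw [← Submodule.span_int_eq_addSubgroupClosure (Set.range e), Submodule.mem_toAddSubgroup,
      Submodule.mem_span_range_iff_exists_fun] at hy
    obtain ⟨c, rfl⟩ := hy
    simp [key c h0]
  · exact AddSubgroup.sum_mem _ fun t _ =>
      AddSubgroup.zsmul_mem _ (AddSubgroup.subset_closure (Set.mem_range_self t)) _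
  · rw [hμ]
    simp_rw [Finset.mul_sum, ← mul_assoc]
    rw [Finset.sum_comm]
    simp_rw [← Finset.sum_mul, hB2]
    simp

/-! ### Elementwise description of modules and their morphisms -/

section Elementwise

variable {k : Type v} [Field k] {Q : Type u} [PartialOrder Q]

/-- The structure map of a module along a relation `a ≤ b`. -/
def act (M : PMod k Q) {a b : Q} (h : a ≤ b) : M.obj a →ₗ[k] M.obj b :=
  (M.map (homOfLE h)).hom.hom

/-- The component of a morphism of modules at a point. -/
def component {M N : PMod k Q} (φ : M ⟶ N) (a : Q) : M.obj a →ₗ[k] N.obj a :=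
  (φ.app a).hom.hom

theorem act_refl (M : PMod k Q) {a : Q} (x : M.obj a) : act M (le_refl a) x = x := by
  have : M.map (homOfLE (le_refl a)) = 𝟙 _ := M.map_id a
  rw [act, this]
  rfl

theorem act_act (M : PMod k Q) {a b c : Q} (h : a ≤ b) (h' : b ≤ c) (x : M.obj a) :
    act M h' (act M h x) = act M (h.trans h') x := by
  have : M.map (homOfLE (h.trans h')) = M.map (homOfLE h) ≫ M.map (homOfLE h') :=
    M.map_comp (homOfLE h) (homOfLE h')
  rw [act, act, act, this]
  rfl

theorem component_act {M N : PMod k Q} (φ : M ⟶ N) {a b : Q} (h : a ≤ b) (x : M.obj a) :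
    component φ b (act M h x) = act N h (component φ a x) :=
  congrArg (fun ψ : M.obj a ⟶ N.obj b => ψ.hom.hom x) (φ.naturality (homOfLE h))

theorem component_comp {L M N : PMod k Q} (φ : L ⟶ M) (ψ : M ⟶ N) {a : Q} (x : L.obj a) :
    component (φ ≫ ψ) a x = component ψ a (component φ a x) := rfl

theorem component_id {M : PMod k Q} {a : Q} (x : M.obj a) : component (𝟙 M) a x = x := rfl

theorem component_zero {M N : PMod k Q} {a : Q} (x : M.obj a) :
    component (0 : M ⟶ N) a x = 0 := rfl

theorem hom_ext_component {M N : PMod k Q} {φ ψ : M ⟶ N}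
    (h : ∀ a (x : M.obj a), component φ a x = component ψ a x) : φ = ψ := by
  apply NatTrans.ext
  funext a
  apply FGModuleCat.hom_ext
  exact LinearMap.ext (h a)

/-- A morphism of modules from its components. -/
def homOfComponents {M N : PMod k Q} (φ : ∀ a, M.obj a →ₗ[k] N.obj a)
    (hφ : ∀ {a b : Q} (h : a ≤ b) (x : M.obj a), φ b (act M h x) = act N h (φ a x)) :
    M ⟶ N where
  app a := ConcreteCategory.ofHom (C := FGModuleCat.{v} k) (φ a)
  naturality a b h := by
    apply FGModuleCat.hom_ext
    exact LinearMap.ext (hφ (leOfHom h))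

/-- Isomorphic modules have isomorphic spaces at each point. -/
def componentEquiv {M N : PMod k Q} (e : M ≅ N) (a : Q) : M.obj a ≃ₗ[k] N.obj a :=
  LinearEquiv.ofLinearMap (component e.hom a) (component e.inv a)
    (LinearMap.ext fun x => by
      rw [LinearMap.comp_apply, ← component_comp, e.inv_hom_id]; rfl)
    (LinearMap.ext fun x => by
      rw [LinearMap.comp_apply, ← component_comp, e.hom_inv_id]; rfl)

/-- A morphism with bijective components is an isomorphism. -/
def isoOfComponents {M N : PMod k Q} (φ : ∀ a, M.obj a ≃ₗ[k] N.obj a)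
    (hφ : ∀ {a b : Q} (h : a ≤ b) (x : M.obj a), φ b (act M h x) = act N h (φ a x)) : M ≅ N where
  hom := homOfComponents (fun a => (φ a).toLinearMap) hφ
  inv := homOfComponents (fun a => (φ a).symm.toLinearMap) fun {a b} h x => by
    apply (φ b).injective
    have := hφ h ((φ a).symm x)
    simp only [LinearEquiv.coe_coe, LinearEquiv.apply_symm_apply] at this ⊢
    exact this.symm
  hom_inv_id := hom_ext_component fun a x => (φ a).symm_apply_apply x
  inv_hom_id := hom_ext_component fun a x => (φ a).apply_symm_apply x

theorem isZero_iff_forall {M : PMod k Q} : IsZero M ↔ ∀ a (x : M.obj a), x = 0 := by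
  rw [IsZero.iff_id_eq_zero]
  refine ⟨fun h a x => ?_, fun h => hom_ext_component fun a x => ?_⟩
  · rw [← component_id x, h]
    rfl
  · exact (h a _).trans (h a _).symm

/-- The functor sending a module to its space at a point. -/
def evalFunctor (k : Type v) [Field k] {Q : Type u} [PartialOrder Q] (a : Q) :
    PMod k Q ⥤ ModuleCat.{v} k where
  obj M := ModuleCat.of k (M.obj a)
  map φ := ModuleCat.ofHom (component φ a)

instance (a : Q) : (evalFunctor k a).Additive where

theorem isAdditiveInvariant_dim (a : Q) :
    IsAdditiveInvariant fun M : PMod k Q => (Module.finrank k (M.obj a) : ℤ) :=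
  isAdditiveInvariant_finrank (evalFunctor k a)
    fun M => inferInstanceAs (Module.Finite k (M.obj a))

end Elementwise

/-! ### Interval modules -/

section IntervalModules

variable {k : Type v} [Field k] {Q : Type u} [PartialOrder Q]

/-- The element of `𝕀_S` at a point of `S` with the given coordinate. -/
def intervalElt (S : Set Q) [S.OrdConnected] {a : Q} (ha : a ∈ S) (c : k) :
    (intervalModule k S).obj a :=
  (⟨c, fun h => absurd ha h⟩ : intervalSpace k S a)

/-- The coordinate of an element of `𝕀_S`. -/
def intervalCoord (S : Set Q) [S.OrdConnected] (a : Q) : (intervalModule k S).obj a →ₗ[k] k :=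
  (intervalSpace k S a).subtype

theorem intervalCoord_injective (S : Set Q) [S.OrdConnected] (a : Q) :
    Function.Injective (intervalCoord (k := k) S a) :=
  Subtype.val_injective

theorem intervalCoord_intervalElt (S : Set Q) [S.OrdConnected] {a : Q} (ha : a ∈ S) (c : k) :
    intervalCoord S a (intervalElt S ha c) = c := rfl

theorem intervalCoord_eq_zero (S : Set Q) [S.OrdConnected] {a : Q} (ha : a ∉ S)
    (x : (intervalModule k S).obj a) : intervalCoord S a x = 0 :=
  x.2 ha

theorem intervalCoord_act (S : Set Q) [S.OrdConnected] {a b : Q} (h : a ≤ b) (hb : b ∈ S)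
    (x : (intervalModule k S).obj a) :
    intervalCoord S b (act (intervalModule k S) h x) = intervalCoord S a x :=
  if_pos hb

theorem not_isZero_interval {S : Set Q} [S.OrdConnected] {a : Q} (ha : a ∈ S) :
    ¬IsZero (intervalModule k S) := fun h => by
  have := congrArg (intervalCoord S a) (isZero_iff_forall.1 h a (intervalElt S ha (1 : k)))
  rw [intervalCoord_intervalElt, map_zero] at this
  exact one_ne_zero this

theorem finrank_interval_of_mem {S : Set Q} [S.OrdConnected] {a : Q} (ha : a ∈ S) :
    Module.finrank k ((intervalModule k S).obj a) = 1 := by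
  have e : (intervalModule k S).obj a ≃ₗ[k] k :=
    LinearEquiv.ofBijective (intervalCoord S a)
      ⟨intervalCoord_injective S a, fun c => ⟨intervalElt S ha c, rfl⟩⟩
  rw [e.finrank_eq, Module.finrank_self]

theorem intervalModule_congr {S T : Set Q} [hS : S.OrdConnected] [hT : T.OrdConnected]
    (h : S = T) : Nonempty (intervalModule k S ≅ intervalModule k T) := by
  subst h
  exact ⟨Iso.refl _⟩

/-- The set is the support of the module, and dimensions at points are invariant under isomorphism.
-/
theorem eq_of_interval_iso {S T : Set Q} [hS : S.OrdConnected] [hT : T.OrdConnected]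
    (h : Nonempty (intervalModule k S ≅ intervalModule k T)) : S = T := by
  have key {S T : Set Q} [hS : S.OrdConnected] [hT : T.OrdConnected]
      (e : intervalModule k S ≅ intervalModule k T) : S ⊆ T := fun a ha => by
    by_contra hb
    have h1 := (componentEquiv e a).finrank_eq
    rw [finrank_interval_of_mem ha] at h1
    obtain ⟨x, hx⟩ := Module.finrank_pos_iff_exists_ne_zero.1 (h1 ▸ one_pos)
    exact hx (intervalCoord_injective T a
      ((intervalCoord_eq_zero T hb x).trans (map_zero _).symm))
  obtain ⟨e⟩ := h
  exact (key e).antisymm (key e.symm)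

/-- Restricting an interval module along an order-embedding gives an interval module. -/
def restrictInterval {X : Type w} [PartialOrder X] (f : X ↪o Q) (S : Set Q) [S.OrdConnected]
    (T : Set X) [T.OrdConnected] (h : f ⁻¹' S = T) :
    (restrict k f).obj (intervalModule k S) ≅ intervalModule k T :=
  isoOfComponents
    (fun a => LinearEquiv.ofEq (intervalSpace k S (f a)) (intervalSpace k T a) (by
      ext x
      change (f a ∉ S → x = 0) ↔ (a ∉ T → x = 0)
      rw [← h]
      rfl)) fun {a b} hab x => by
    apply intervalCoord_injective T
    by_cases hb : b ∈ T
    · have hb' : f b ∈ S := by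
        rw [← h] at hb
        exact hb
      rw [intervalCoord_act T hab hb]
      exact intervalCoord_act S (f.monotone hab) hb' x
    · rw [intervalCoord_eq_zero T hb, intervalCoord_eq_zero T hb]

/-- The morphism from an interval module given by a compatible family of elements. -/
def homOfInterval {N : PMod k Q} (S : Set Q) [S.OrdConnected] (v : ∀ a, N.obj a)
    (hv : ∀ {a b : Q} (h : a ≤ b), a ∈ S → act N h (v a) = v b)
    (hv0 : ∀ {a : Q}, a ∉ S → v a = 0) : intervalModule k S ⟶ N :=
  homOfComponents (fun a => (intervalCoord S a).smulRight (v a)) fun {a b} h x => by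
    by_cases ha : a ∈ S
    · by_cases hb : b ∈ S
      · simp [intervalCoord_act S h hb, hv h ha]
      · simp [hv h ha, hv0 hb]
    · have : x = 0 := intervalCoord_injective S a
        ((intervalCoord_eq_zero S ha x).trans (map_zero _).symm)
      simp [this]

/-- The morphism to an interval module given by a compatible family of functionals. -/
def homToInterval {N : PMod k Q} (S : Set Q) [S.OrdConnected] (φ : ∀ a, N.obj a →ₗ[k] k)
    (hφ : ∀ {a b : Q} (h : a ≤ b), b ∈ S → ∀ x, φ b (act N h x) = φ a x)
    (hφ0 : ∀ {a : Q}, a ∉ S → φ a = 0) : N ⟶ intervalModule k S :=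
  homOfComponents (fun a => LinearMap.codRestrict (intervalSpace k S a) (φ a)
      fun x ha => by rw [hφ0 ha]; rfl) fun {a b} h x => by
    apply intervalCoord_injective S
    by_cases hb : b ∈ S
    · rw [intervalCoord_act S h hb]
      exact hφ h hb x
    · rw [intervalCoord_eq_zero S hb, intervalCoord_eq_zero S hb]

/-- An interval module is a retract of a module with compatible elements and functionals that
pair to one. -/
theorem nonempty_retract_interval {N : PMod k Q} (S : Set Q) [S.OrdConnected] (v : ∀ a, N.obj a)
    (φ : ∀ a, N.obj a →ₗ[k] k)
    (hv : ∀ {a b : Q} (h : a ≤ b), a ∈ S → act N h (v a) = v b)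
    (hv0 : ∀ {a : Q}, a ∉ S → v a = 0)
    (hφ : ∀ {a b : Q} (h : a ≤ b), b ∈ S → ∀ x, φ b (act N h x) = φ a x)
    (hφ0 : ∀ {a : Q}, a ∉ S → φ a = 0) (h1 : ∀ {a : Q}, a ∈ S → φ a (v a) = 1) :
    Nonempty (Retract (intervalModule k S) N) :=
  ⟨{  i := homOfInterval S v hv hv0
      r := homToInterval S φ hφ hφ0
      retract := hom_ext_component fun a x => by
        apply intervalCoord_injective S
        change φ a (intervalCoord S a x • v a) = intervalCoord S a x
        by_cases ha : a ∈ S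
        · rw [map_smul, h1 ha, smul_eq_mul, mul_one]
        · rw [intervalCoord_eq_zero S ha, zero_smul, map_zero] }⟩

/-- A module that is one-dimensional at some point, and such that morphisms into it and morphisms
out of it are determined at that point, is indecomposable. -/
theorem indecomposable_of_determined {N : PMod k Q} (a : Q)
    (ha : Module.finrank k (N.obj a) = 1)
    (h : (∀ (Z : PMod k Q) (φ : N ⟶ Z), component φ a = 0 → φ = 0) ∨
      (∀ (Z : PMod k Q) (φ : Z ⟶ N), component φ a = 0 → φ = 0)) : Indecomposable N := by
  have hd := isAdditiveInvariant_dim (k := k) a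
  -- The identity of a retract `Y` factors through `N`. If `Y` vanishes at `a`, one of the two
  -- factors has zero component there, hence is zero.
  have key {Y Z : PMod k Q} (ι : Y ⟶ N) (π : N ⟶ Y) (hπ : ι ≫ π = 𝟙 Y)
      (hY : Module.finrank k (Y.obj a) = 0) : IsZero Y := by
    rw [IsZero.iff_id_eq_zero, ← hπ]
    have := Module.finrank_zero_iff.1 hY
    rcases h with h | h
    · rw [h Y π (LinearMap.ext fun x => Subsingleton.elim _ _), comp_zero]
    · have : component ι a = 0 := LinearMap.ext fun x => by
        rw [Subsingleton.elim x 0, map_zero, map_zero]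
      rw [h Y ι this, zero_comp]
  refine ⟨fun hN => ?_, fun Y Z e => ?_⟩
  · have := hd.of_isZero hN
    rw [ha] at this
    exact one_ne_zero this
  · have h1 := (hd.iso ⟨e⟩).symm.trans (congrArg Nat.cast ha)
    rw [hd.biprod] at h1
    -- The single dimension at `a` is shared between the two summands, so one of them vanishes at
    -- `a`.
    have h2 : Module.finrank k (Y.obj a) = 0 ∨ Module.finrank k (Z.obj a) = 0 := by omega
    refine h2.imp (key (Z := Z) (biprod.inl ≫ e.inv) (e.hom ≫ biprod.fst) (by simp))
      (key (Z := Y) (biprod.inr ≫ e.inv) (e.hom ≫ biprod.snd) (by simp))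

/-- The module is generated by its space at the least point, so morphisms out of it are determined
there. -/
theorem indecomposable_interval_of_isLeast {S : Set Q} [S.OrdConnected] {a : Q}
    (ha : IsLeast S a) : Indecomposable (intervalModule k S) := by
  refine indecomposable_of_determined a (finrank_interval_of_mem ha.1) (Or.inl fun Z φ h => ?_)
  refine hom_ext_component fun b x => ?_
  by_cases hb : b ∈ S
  · have : x = act (intervalModule k S) (ha.2 hb) (intervalElt S ha.1 (intervalCoord S b x)) := by
      apply intervalCoord_injective S
      rw [intervalCoord_act S _ hb, intervalCoord_intervalElt]
    rw [this, component_act, h, component_zero, LinearMap.zero_apply, map_zero]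
  · have : x = 0 := intervalCoord_injective S b
      ((intervalCoord_eq_zero S hb x).trans (map_zero _).symm)
    rw [this, map_zero, map_zero]

/-- Every element is detected by its image at the greatest point, so morphisms into the module are
determined there. -/
theorem indecomposable_interval_of_isGreatest {S : Set Q} [S.OrdConnected] {a : Q}
    (ha : IsGreatest S a) : Indecomposable (intervalModule k S) := by
  refine indecomposable_of_determined a (finrank_interval_of_mem ha.1) (Or.inr fun Z φ h => ?_)
  refine hom_ext_component fun b x => ?_
  apply intervalCoord_injective S
  by_cases hb : b ∈ S
  · rw [← intervalCoord_act S (ha.2 hb) ha.1, ← component_act, h, component_zero,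
      LinearMap.zero_apply, map_zero, map_zero]
  · rw [intervalCoord_eq_zero S hb, component_zero, map_zero]

end IntervalModules

/-! ### Intermediate extensions -/

section IntermediateExtension

variable {k : Type v} [Field k] {Q : Type u} [PartialOrder Q] {X : Type w} [PartialOrder X]

/-- A module that restricts to `U`, and such that morphisms out of it and morphisms into it are
determined by their restrictions, is the intermediate extension of `U`. -/
theorem nonempty_iso_Theta [Finite X] (f : X ↪o Q) (U : PMod k X) (N : PMod k Q)
    (e : U ≅ (restrict k f).obj N)
    (hout : ∀ (Z : PMod k Q) (φ ψ : N ⟶ Z),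
      (restrict k f).map φ = (restrict k f).map ψ → φ = ψ)
    (hin : ∀ (Z : PMod k Q) (φ ψ : Z ⟶ N),
      (restrict k f).map φ = (restrict k f).map ψ → φ = ψ) :
    Nonempty (N ≅ Theta f U) := by
  -- The adjuncts `p` and `m` of `e` and its inverse factor `theta f U` through `N`. The two
  -- hypotheses make `p` epi and `m` mono, so `N` is the image.
  let p : (induction k f).obj U ⟶ N := ((inductionAdj k f).homEquiv U N).symm e.hom
  let m : N ⟶ (coinduction k f).obj U := (coinductionAdj k f).homEquiv N U e.inv
  have hp : (inductionAdj k f).homEquiv U N p = e.hom := Equiv.apply_symm_apply _ _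
  have hm : ((coinductionAdj k f).homEquiv N U).symm m = e.inv := Equiv.symm_apply_apply _ _
  have hm' : (restrict k f).map m ≫ (coinductionAdj k f).counit.app U = e.inv :=
    ((coinductionAdj k f).homEquiv_counit _ _ m).symm.trans hm
  have : Epi p := ⟨fun φ ψ h => by
    apply hout
    rw [← cancel_epi e.hom, ← hp, ← Adjunction.homEquiv_naturality_right,
      ← Adjunction.homEquiv_naturality_right, h]⟩
  have : Mono m := ⟨fun φ ψ h => by
    apply hin
    rw [← cancel_mono e.inv, ← hm, ← Adjunction.homEquiv_naturality_left_symm,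
      ← Adjunction.homEquiv_naturality_left_symm, h]⟩
  have comm : p ≫ m = theta f U := by
    rw [theta, ← Adjunction.homEquiv_naturality_right_symm]
    congr 1
    rw [← cancel_mono ((coinductionAdj k f).counit.app U), IsIso.inv_hom_id, Category.assoc, hm',
      e.hom_inv_id]
  have : StrongEpi p := strongEpi_of_epi p
  exact ⟨image.isoStrongEpiMono p m comm⟩

/-- The order-convex hull of the image of a subset under an order-embedding. -/
def hull (f : X ↪o Q) (S : Set X) : Set Q := {p | ∃ s ∈ S, ∃ t ∈ S, f s ≤ p ∧ p ≤ f t}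

instance (f : X ↪o Q) (S : Set X) : (hull f S).OrdConnected where
  out' := by
    rintro x ⟨s, hs, _, _, hsx, _⟩ y ⟨_, _, t, ht, _, hyt⟩ z ⟨hxz, hzy⟩
    exact ⟨s, hs, t, ht, hsx.trans hxz, hzy.trans hyt⟩

theorem map_mem_hull (f : X ↪o Q) {S : Set X} {s : X} (hs : s ∈ S) : f s ∈ hull f S :=
  ⟨s, hs, s, hs, le_rfl, le_rfl⟩

theorem preimage_hull (f : X ↪o Q) (S : Set X) [hS : S.OrdConnected] : f ⁻¹' hull f S = S := by
  ext x
  refine ⟨?_, map_mem_hull f⟩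
  rintro ⟨s, hs, t, ht, h1, h2⟩
  exact hS.out hs ht ⟨f.le_iff_le.1 h1, f.le_iff_le.1 h2⟩

/-- Hull and preimage are adjoint on convex sets. This turns the rank of a restricted interval
module, `S ⊆ f ⁻¹' T`, into an inclusion between subsets of the large poset. -/
theorem hull_subset_iff (f : X ↪o Q) (S : Set X) (T : Set Q) [hT : T.OrdConnected] :
    hull f S ⊆ T ↔ S ⊆ f ⁻¹' T := by
  refine ⟨fun h s hs => h (map_mem_hull f hs), ?_⟩
  rintro h p ⟨s, hs, t, ht, h1, h2⟩
  exact hT.out (h hs) (h ht) ⟨h1, h2⟩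

theorem isLeast_hull (f : X ↪o Q) {S : Set X} {a : X} (ha : IsLeast S a) :
    IsLeast (hull f S) (f a) := by
  refine ⟨map_mem_hull f ha.1, ?_⟩
  rintro p ⟨s, hs, -, -, h, -⟩
  exact (f.monotone (ha.2 hs)).trans h

theorem isGreatest_hull (f : X ↪o Q) {S : Set X} {a : X} (ha : IsGreatest S a) :
    IsGreatest (hull f S) (f a) := by
  refine ⟨map_mem_hull f ha.1, ?_⟩
  rintro p ⟨-, -, t, ht, -, h⟩
  exact h.trans (f.monotone (ha.2 ht))

/-- The intermediate extension of an interval module is the interval module of the hull. -/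
theorem nonempty_hull_iso_Theta [Finite X] (f : X ↪o Q) (S : Set X) [S.OrdConnected] (U : PMod k X)
    (e : Nonempty (U ≅ intervalModule k S)) :
    Nonempty (intervalModule k (hull f S) ≅ Theta f U) := by
  obtain ⟨e⟩ := e
  have hres {M N : PMod k Q} {φ ψ : M ⟶ N}
      (h : (restrict k f).map φ = (restrict k f).map ψ) (s : X) :
      component φ (f s) = component ψ (f s) := congrArg (fun χ => component χ s) h
  refine nonempty_iso_Theta f U _
    (e ≪≫ (restrictInterval f (hull f S) S (preimage_hull f S)).symm)
    (fun Z φ ψ h => hom_ext_component fun p x => ?_)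
    (fun Z φ ψ h => hom_ext_component fun p x => ?_)
  · by_cases hp : p ∈ hull f S
    -- A point of the hull lies above some `f s`, and each element there comes from `f s`, where the
    -- two morphisms agree.
    · obtain ⟨s, hs, -, -, hsp, -⟩ := id hp
      have : x = act (intervalModule k (hull f S)) hsp
          (intervalElt _ (map_mem_hull f hs) (intervalCoord _ p x)) := by
        apply intervalCoord_injective
        rw [intervalCoord_act _ _ hp, intervalCoord_intervalElt]
      rw [this, component_act, component_act, hres h]
    · have : x = 0 := intervalCoord_injective _ p
        ((intervalCoord_eq_zero _ hp x).trans (map_zero _).symm)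
      rw [this, map_zero, map_zero]
  · apply intervalCoord_injective
    by_cases hp : p ∈ hull f S
    -- A point of the hull lies below some `f t`, and coordinates can be compared after moving to `f
    -- t`.
    · obtain ⟨-, -, t, ht, -, hpt⟩ := id hp
      have ht' := map_mem_hull f ht
      rw [← intervalCoord_act _ hpt ht', ← intervalCoord_act _ hpt ht', ← component_act,
        ← component_act, hres h]
    · rw [intervalCoord_eq_zero _ hp, intervalCoord_eq_zero _ hp]

end IntermediateExtension

/-! ### Rank families and bases of multiplicity invariants -/

section RankFamily

variable {k : Type v} [Field k] {X : Type w} [PartialOrder X]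

open Classical in
/-- A family `r` of additive invariants of `X`-modules, indexed by a set `𝒮` of order-convex
subsets, such that `r S` takes the value one on `𝕀_T` if `S ⊆ T` and zero otherwise, and such that
each nonzero `X`-module has a retract `𝕀_S` with `S ∈ 𝒮`. -/
structure IsRankFamily (𝒮 : Set (Set X)) (r : Set X → PMod k X → ℤ) : Prop where
  ordConnected : ∀ S ∈ 𝒮, S.OrdConnected
  additive : ∀ S ∈ 𝒮, IsAdditiveInvariant (r S)
  interval : ∀ S ∈ 𝒮, ∀ (T : Set X) [T.OrdConnected],
    r S (intervalModule k T) = if S ⊆ T then 1 else 0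
  indecomposable : ∀ S ∈ 𝒮, ∀ [S.OrdConnected], Indecomposable (intervalModule k S)
  exists_retract : ∀ N : PMod k X, ¬IsZero N →
    ∃ S ∈ 𝒮, ∃ _ : S.OrdConnected, Nonempty (Retract (intervalModule k S) N)

variable {𝒮 : Set (Set X)} {r : Set X → PMod k X → ℤ}

/-- The interval retract splits off as a nonzero direct summand, so by indecomposability its
complement is zero. -/
theorem IsRankFamily.exists_iso_interval (h : IsRankFamily 𝒮 r) {V : PMod k X}
    (hV : Indecomposable V) :
    ∃ S ∈ 𝒮, ∃ _ : S.OrdConnected, Nonempty (V ≅ intervalModule k S) := by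
  obtain ⟨S, hS, hc, ⟨ρ⟩⟩ := h.exists_retract V hV.1
  obtain ⟨Z, ⟨e⟩⟩ := nonempty_iso_biprod_of_retract ρ
  refine ⟨S, hS, hc, ?_⟩
  rcases hV.2 _ _ e with h0 | h0
  · exact absurd h0 (h.indecomposable S hS).1
  · exact ⟨e ≪≫ (isoBiprodZero h0).symm⟩

/-- Induction on total dimension: splitting off an interval retract leaves a smaller complement. -/
theorem IsRankFamily.exists_decomposition [Finite X] (h : IsRankFamily 𝒮 r) (N : PMod k X) :
    ∃ (n : ℕ) (V : Fin n → PMod k X), IsDecomposition N V := by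
  have := Fintype.ofFinite X
  induction hd : ∑ x, Module.finrank k (N.obj x) using Nat.strong_induction_on generalizing N with
  | _ d ih =>
  by_cases hN : IsZero N
  · refine ⟨0, Fin.elim0, fun i => i.elim0, ⟨hN.iso ((IsZero.iff_id_eq_zero _).2 ?_)⟩⟩
    exact biproduct.hom_ext _ _ fun i => i.elim0
  · obtain ⟨S, hS, hc, ⟨ρ⟩⟩ := h.exists_retract N hN
    obtain ⟨Z, ⟨e⟩⟩ := nonempty_iso_biprod_of_retract ρ
    have hadd (x : X) : Module.finrank k (N.obj x) =
        Module.finrank k ((intervalModule k S).obj x) + Module.finrank k (Z.obj x) := by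
      have hx := isAdditiveInvariant_dim (k := k) x
      have := hx.iso ⟨e⟩
      rw [hx.biprod] at this
      exact_mod_cast this
    have hpos : 0 < ∑ x, Module.finrank k ((intervalModule k S).obj x) := by
      rw [Nat.pos_iff_ne_zero]
      intro h0
      refine (h.indecomposable S hS).1 (isZero_iff_forall.2 fun x y => ?_)
      have := Module.finrank_zero_iff.1 (Finset.sum_eq_zero_iff.1 h0 x (Finset.mem_univ x))
      exact Subsingleton.elim _ _
    obtain ⟨n, V, hV, ⟨e'⟩⟩ := ih (∑ x, Module.finrank k (Z.obj x)) (by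
      rw [← hd, Finset.sum_congr rfl fun x _ => hadd x, Finset.sum_add_distrib]
      omega) Z rfl
    refine ⟨n + 1, Fin.cons (intervalModule k S) V, Fin.cases (h.indecomposable S hS) hV,
      ⟨e ≪≫ biprod.mapIso (Iso.refl _) e' ≪≫
        (biproductFinSucc (Fin.cons (intervalModule k S) V : Fin (n + 1) → PMod k X)).symm⟩⟩

open Classical in
/-- Multiplicities exist, and they are integral combinations of the ranks and conversely. -/
theorem IsRankFamily.exists_multiplicity [Finite X] [Fintype 𝒮] (h : IsRankFamily 𝒮 r) :
    ∃ (m : 𝒮 → PMod k X → ℤ) (B : 𝒮 → 𝒮 → ℤ),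
      (∀ (S : 𝒮) N, m S N = ∑ S' : 𝒮, B S S' * r S' N) ∧
      (∀ (S : 𝒮) N, r S N = ∑ S' : 𝒮, (if S ≤ S' then 1 else 0) * m S' N) ∧
      ∀ (S : 𝒮) [S.1.OrdConnected] (U : PMod k X), Nonempty (U ≅ intervalModule k S.1) →
        ∀ N, ∃ n : ℕ, IsMultiplicity U N n ∧ m S N = n := by
  obtain ⟨B, hB1, hB2⟩ := exists_inverse_zeta 𝒮
  refine ⟨fun S N => ∑ S' : 𝒮, B S S' * r S' N, B, fun _ _ => rfl, fun S N => ?_,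
    fun S hSc U hU N => ?_⟩
  · simp_rw [Finset.mul_sum, ← mul_assoc]
    rw [Finset.sum_comm]
    simp_rw [← Finset.sum_mul, hB2]
    simp
  -- In any decomposition, the rank over `S'` counts the summands whose support contains `S'`. The
  -- inverse zeta matrix turns this into the number of summands with support `S`. The left side does
  -- not mention the decomposition, so multiplicities are well defined without Krull–Schmidt.
  · have key (n : ℕ) (V : Fin n → PMod k X) (hV : IsDecomposition N V) :
        ∑ S' : 𝒮, B S S' * r S' N = Nat.card {i : Fin n // Nonempty (V i ≅ U)} := by
      obtain ⟨hV, hN⟩ := hV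
      choose σ hσ hc e using fun i => h.exists_iso_interval (hV i)
      have hr (S' : 𝒮) : r S' N = ∑ i, if S' ≤ ⟨σ i, hσ i⟩ then 1 else 0 := by
        have hadd := h.additive S'.1 S'.2
        rw [hadd.iso hN, hadd.biproduct]
        exact Finset.sum_congr rfl fun i _ => by
          rw [hadd.iso (e i), h.interval S'.1 S'.2]
          rfl
      simp_rw [hr, Finset.mul_sum]
      rw [Finset.sum_comm]
      simp_rw [hB1]
      rw [Nat.card_eq_fintype_card, Fintype.card_subtype, Finset.natCast_card_filter]
      refine Finset.sum_congr rfl fun i _ => ?_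
      congr 1
      rw [eq_iff_iff]
      obtain ⟨e₁⟩ := hU
      obtain ⟨e₂⟩ := e i
      refine ⟨fun hi => ?_, fun ⟨e₃⟩ => Subtype.ext (eq_of_interval_iso
        (k := k) ⟨e₁.symm ≪≫ e₃.symm ≪≫ e₂⟩)⟩
      obtain ⟨e₄⟩ := intervalModule_congr (k := k) (congrArg Subtype.val hi).symm
      exact ⟨e₂ ≪≫ e₄ ≪≫ e₁.symm⟩
    obtain ⟨n, V, hV⟩ := h.exists_decomposition N
    refine ⟨_, ⟨⟨n, V, hV⟩, fun n' V' hV' => ?_⟩, key n V hV⟩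
    exact_mod_cast (key n' V' hV').symm.trans (key n V hV)

theorem IsAdditiveInvariant.restrict {P : Type u} [PartialOrder P] (f : X ↪o P)
    {r : PMod k X → ℤ} (h : IsAdditiveInvariant r) :
    IsAdditiveInvariant fun M : PMod k P => r ((restrict k f).obj M) where
  iso := fun ⟨e⟩ => h.iso ⟨(PosetRep.restrict k f).mapIso e⟩
  biprod M N := by
    have : (PosetRep.restrict k f).Additive := ⟨fun {_ _ _ _} => rfl⟩
    have := preservesBinaryBiproducts_of_preservesBiproducts (PosetRep.restrict k f)
    rw [h.iso ⟨(PosetRep.restrict k f).mapBiprod M N⟩, h.biprod]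

variable {P : Type u} [PartialOrder P]

/-- The members of the set of intermediate extensions are the interval modules of the hulls. -/
theorem IsRankFamily.exists_intermediateExtension_iff [Finite X] (h : IsRankFamily 𝒮 r)
    (E : Set (X ↪o P)) (I : Set (PMod k X)) (hI : IsIndRepresentatives (PMod k X) I)
    (N : PMod k P) :
    (∃ R ∈ intermediateExtensions E I, Nonempty (N ≅ R)) ↔
      ∃ f ∈ E, ∃ S ∈ 𝒮, Nonempty (N ≅ intervalModule k (hull f S)) := by
  constructor
  · rintro ⟨_, ⟨f, hf, U, hU, rfl⟩, ⟨e⟩⟩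
    obtain ⟨S, hS, hc, e'⟩ := h.exists_iso_interval (hI.1 U hU)
    obtain ⟨e''⟩ := nonempty_hull_iso_Theta f S U e'
    exact ⟨f, hf, S, hS, ⟨e ≪≫ e''.symm⟩⟩
  · rintro ⟨f, hf, S, hS, ⟨e⟩⟩
    have := h.ordConnected S hS
    obtain ⟨U, ⟨hU, ⟨e'⟩⟩, -⟩ := hI.2 _ (h.indecomposable S hS)
    obtain ⟨e''⟩ := nonempty_hull_iso_Theta f S U ⟨e'.symm⟩
    exact ⟨_, ⟨f, hf, U, hU, rfl⟩, ⟨e ≪≫ e''⟩⟩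

open Classical in
/-- The intermediate extensions form a basis of the multiplicity invariant. -/
theorem IsRankFamily.isBasisOfInvariant [Finite X] [Finite P] (h : IsRankFamily 𝒮 r)
    (hind : ∀ (f : X ↪o P), ∀ S ∈ 𝒮, Indecomposable (intervalModule k (hull f S)))
    (hhull : ∀ (f g : X ↪o P), ∀ S ∈ 𝒮, ∀ T ∈ 𝒮, hull f S = hull g T →
      ∀ M : PMod k P, r S ((restrict k f).obj M) = r T ((restrict k g).obj M))
    (E : Set (X ↪o P)) (I : Set (PMod k X)) (hI : IsIndRepresentatives (PMod k X) I) :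
    ∃ Ψ : K0sp (PMod k P) →+ (E × I → ℤ),
      IsMultInvariant E I Ψ ∧ IsBasisOfInvariant Ψ (intermediateExtensions E I) := by
  have := Fintype.ofFinite 𝒮
  obtain ⟨m, B, hmB, hrm, hm⟩ := h.exists_multiplicity
  choose τ hτ hτc hτe using fun U : I => h.exists_iso_interval (hI.1 U.1 U.2)
  have hτs (S : 𝒮) : ∃ U : I, τ U = S.1 := by
    have := h.ordConnected S.1 S.2
    obtain ⟨U, ⟨hU, ⟨e⟩⟩, -⟩ := hI.2 _ (h.indecomposable S.1 S.2)
    obtain ⟨e'⟩ := hτe ⟨U, hU⟩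
    exact ⟨⟨U, hU⟩, (eq_of_interval_iso (k := k) ⟨e ≪≫ e'⟩).symm⟩
  have hmadd (S : 𝒮) : IsAdditiveInvariant (m S) := by
    rw [funext (hmB S)]
    exact IsAdditiveInvariant.sum _ _ fun S' _ => h.additive S'.1 S'.2
  obtain ⟨mh, hmh⟩ : ∃ mh : (X ↪o P) → 𝒮 → K0sp (PMod k P) →+ ℤ,
      ∀ f S M, mh f S (K0sp.cls M) = m S ((restrict k f).obj M) :=
    ⟨fun f S => K0sp.lift _ ((hmadd S).restrict f), fun f S M => K0sp.lift_cls _ _ _⟩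
  obtain ⟨ρ, hρ⟩ : ∃ ρ : (X ↪o P) → 𝒮 → K0sp (PMod k P) →+ ℤ,
      ∀ f (S : 𝒮) M, ρ f S (K0sp.cls M) = r S ((restrict k f).obj M) :=
    ⟨fun f S => K0sp.lift _ ((h.additive S.1 S.2).restrict f), fun f S M => K0sp.lift_cls _ _ _⟩
  have hmhρ (f : X ↪o P) (S : 𝒮) (x) : mh f S x = ∑ S', B S S' * ρ f S' x :=
    K0sp.eq_sum _ _ _ _ (fun M => by simp_rw [hmh, hρ, hmB]) x
  have hρmh (f : X ↪o P) (S : 𝒮) (x) :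
      ρ f S x = ∑ S', (if S ≤ S' then 1 else 0) * mh f S' x :=
    K0sp.eq_sum _ _ _ _ (fun M => by simp_rw [hmh, hρ, hrm]) x
  let Ψ : K0sp (PMod k P) →+ (E × I → ℤ) :=
    AddMonoidHom.pi fun j => mh j.1.1 ⟨τ j.2, hτ j.2⟩
  let 𝒯 : Set (Set P) := {T | ∃ f ∈ E, ∃ S ∈ 𝒮, T = hull f S}
  -- Different pairs `(f, S)` may have the same hull. One pair is chosen for each hull, and `hhull`
  -- makes the choice immaterial.
  choose φ hφE σ hσ hφσ using fun T : 𝒯 => T.2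
  have hTc (T : 𝒯) : T.1.OrdConnected := by rw [hφσ T]; infer_instance
  let e (T : 𝒯) : K0sp (PMod k P) := K0sp.cls (intervalModule k T.1)
  let μ (T : 𝒯) : K0sp (PMod k P) →+ ℤ := ρ (φ T) ⟨σ T, hσ T⟩
  -- Restriction along `φ S` turns `𝕀_T` into the interval module of the preimage of `T`; the
  -- hull–preimage adjunction then gives the zeta matrix of inclusion on hulls.
  have hμe (S T : 𝒯) : μ S (e T) = if S ≤ T then 1 else 0 := by
    have hc : (φ S ⁻¹' T.1).OrdConnected := (hTc T).preimage_mono (φ S).monotone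
    have h1 : μ S (e T) = r (σ S) (intervalModule k (φ S ⁻¹' T.1)) :=
      (hρ _ _ _).trans ((h.additive _ (hσ S)).iso ⟨restrictInterval (φ S) T.1 _ rfl⟩)
    rw [h1, h.interval _ (hσ S), ← hull_subset_iff, ← hφσ S]
    rfl
  obtain ⟨hli, hinj, hsurj⟩ := zeta_basis e μ hμe
  -- Multiplicities and ranks are integral combinations of each other for each `f`, so they have the
  -- same kernel. Hence a basis for the functionals `μ` is one for `Ψ`.
  have hker (x : K0sp (PMod k P)) : Ψ x = 0 ↔ ∀ T, μ T x = 0 := by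
    constructor
    · intro hx T
      change ρ (φ T) ⟨σ T, hσ T⟩ x = 0
      rw [hρmh]
      refine Finset.sum_eq_zero fun S _ => ?_
      obtain ⟨U, hU⟩ := hτs S
      have h1 : mh (φ T) ⟨τ U, hτ U⟩ x = 0 := congrFun hx (⟨φ T, hφE T⟩, U)
      have h2 : (⟨τ U, hτ U⟩ : 𝒮) = S := Subtype.ext hU
      rw [← h2, h1, mul_zero]
    · intro hx
      funext ⟨f, U⟩
      change mh f.1 ⟨τ U, hτ U⟩ x = 0
      rw [hmhρ]
      refine Finset.sum_eq_zero fun S _ => ?_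
      let T : 𝒯 := ⟨hull f.1 S.1, f.1, f.2, S.1, S.2, rfl⟩
      have h1 : ρ f.1 S = μ T := K0sp.hom_ext fun M => by
        rw [hρ, hhull f.1 (φ T) S.1 S.2 (σ T) (hσ T) (hφσ T) M]
        exact (hρ (φ T) ⟨σ T, hσ T⟩ M).symm
      rw [h1, hx, mul_zero]
  have himage : K0sp.cls '' intermediateExtensions E I = Set.range e := by
    ext c
    constructor
    · rintro ⟨R, hR, rfl⟩
      obtain ⟨f, hf, S, hS, e'⟩ :=
        (h.exists_intermediateExtension_iff E I hI R).1 ⟨R, hR, ⟨Iso.refl _⟩⟩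
      exact ⟨⟨hull f S, f, hf, S, hS, rfl⟩, (K0sp.cls_eq_of_iso e').symm⟩
    · rintro ⟨T, rfl⟩
      obtain ⟨R, hR, e'⟩ := (h.exists_intermediateExtension_iff E I hI (intervalModule k T.1)).2
        ⟨φ T, hφE T, σ T, hσ T, intervalModule_congr (hφσ T)⟩
      exact ⟨R, hR, (K0sp.cls_eq_of_iso e').symm⟩
  have hlift (x : K0sp (PMod k P)) : ∃ y ∈ AddSubgroup.closure (Set.range e), Ψ y = Ψ x := by
    obtain ⟨y, hy, hyx⟩ := hsurj x
    refine ⟨y, hy, sub_eq_zero.1 ?_⟩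
    rw [← map_sub, hker]
    exact fun T => by rw [map_sub, hyx, sub_self]
  refine ⟨Ψ, fun M f U => ?_, ⟨?_, ?_, ?_, ?_⟩⟩
  · obtain ⟨n, hn, hmn⟩ := hm ⟨τ U, hτ U⟩ U.1 (hτe U) ((restrict k f.1).obj M)
    exact ⟨n, hn, (hmh _ _ _).trans hmn⟩
  · rw [AddSubgroup.fg_iff]
    refine ⟨Ψ '' Set.range e, ?_, (Set.finite_range e).image _⟩
    rw [← AddMonoidHom.map_closure]
    refine le_antisymm (fun _ ⟨y, _, hy⟩ => ⟨y, hy⟩) ?_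
    rintro _ ⟨x, rfl⟩
    obtain ⟨y, hy, hyx⟩ := hlift x
    exact ⟨y, hy, hyx⟩
  · rintro _ ⟨f, hf, U, hU, rfl⟩
    obtain ⟨S, hS, hc, e'⟩ := h.exists_iso_interval (hI.1 U hU)
    obtain ⟨e''⟩ := nonempty_hull_iso_Theta f S U e'
    refine ⟨fun h0 => (hind f S hS).1 (h0.of_iso e''), fun Y Z e₃ => ?_⟩
    exact (hind f S hS).2 Y Z (e'' ≪≫ e₃)
  · rw [himage]
    exact hli.linearIndepOn_id
  · rw [himage]
    refine ⟨fun y _ => ⟨y, rfl⟩, fun y hy z hz hyz => ?_, ?_⟩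
    · rw [← sub_eq_zero]
      refine hinj _ (AddSubgroup.sub_mem _ hy hz) ((hker _).1 ?_)
      rw [map_sub, hyz, sub_self]
    · rintro _ ⟨x, rfl⟩
      obtain ⟨y, hy, hyx⟩ := hlift x
      exact ⟨y, hy, hyx⟩

end RankFamily

/-! ### Generalized ranks over subsets with a least or a greatest element -/

section Ranks

variable {k : Type v} [Field k] {Q : Type u} [PartialOrder Q]

/-- The sum of the kernels of the structure maps from `a` to the points of `S`. -/
def kernelSum (M : PMod k Q) (a : Q) (S : Set Q) : Submodule k (M.obj a) :=
  ⨆ (b : Q) (h : a ≤ b) (_ : b ∈ S), LinearMap.ker (act M h)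

/-- The intersection of the images of the structure maps from the points of `S` to `a`. -/
def imageInter (M : PMod k Q) (a : Q) (S : Set Q) : Submodule k (M.obj a) :=
  ⨅ (b : Q) (h : b ≤ a) (_ : b ∈ S), LinearMap.range (act M h)

theorem ker_le_kernelSum (M : PMod k Q) {a b : Q} (h : a ≤ b) {S : Set Q} (hb : b ∈ S) :
    LinearMap.ker (act M h) ≤ kernelSum M a S :=
  le_iSup_of_le b (le_iSup_of_le h (le_iSup_of_le hb le_rfl))

theorem kernelSum_le {M : PMod k Q} {a : Q} {S : Set Q} {K : Submodule k (M.obj a)}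
    (hK : ∀ (b : Q) (h : a ≤ b), b ∈ S → LinearMap.ker (act M h) ≤ K) : kernelSum M a S ≤ K :=
  iSup_le fun b => iSup_le fun h => iSup_le fun hb => hK b h hb

theorem imageInter_le_range (M : PMod k Q) {a b : Q} (h : b ≤ a) {S : Set Q} (hb : b ∈ S) :
    imageInter M a S ≤ LinearMap.range (act M h) :=
  iInf_le_of_le b (iInf_le_of_le h (iInf_le_of_le hb le_rfl))

theorem le_imageInter {M : PMod k Q} {a : Q} {S : Set Q} {K : Submodule k (M.obj a)}
    (hK : ∀ (b : Q) (h : b ≤ a), b ∈ S → K ≤ LinearMap.range (act M h)) : K ≤ imageInter M a S :=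
  le_iInf fun b => le_iInf fun h => le_iInf fun hb => hK b h hb

theorem kernelSum_le_comap {M N : PMod k Q} (φ : M ⟶ N) (a : Q) (S : Set Q) :
    kernelSum M a S ≤ (kernelSum N a S).comap (component φ a) := by
  refine kernelSum_le fun b h hb x hx => ker_le_kernelSum N h hb ?_
  rw [LinearMap.mem_ker] at hx ⊢
  rw [← component_act, hx, map_zero]

theorem component_mem_imageInter {M N : PMod k Q} (φ : M ⟶ N) (a : Q) (S : Set Q) :
    ∀ x ∈ imageInter M a S, component φ a x ∈ imageInter N a S := by
  intro x hx
  have : (imageInter M a S).map (component φ a) ≤ imageInter N a S := by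
    refine le_imageInter fun b h hb => ?_
    rintro _ ⟨y, hy, rfl⟩
    obtain ⟨z, rfl⟩ := imageInter_le_range M h hb hy
    exact ⟨component φ b z, (component_act φ h z).symm⟩
  exact this ⟨x, hx, rfl⟩

/-- The functor sending a module to its space at `a` modulo the kernels of the structure maps
to the points of `S`. -/
def kernelQuotient (k : Type v) [Field k] {Q : Type u} [PartialOrder Q] (a : Q) (S : Set Q) :
    PMod k Q ⥤ ModuleCat.{v} k where
  obj M := ModuleCat.of k (M.obj a ⧸ kernelSum M a S)
  map φ := ModuleCat.ofHom (Submodule.mapQ _ _ (component φ a) (kernelSum_le_comap φ a S))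
  map_id M := by
    apply ModuleCat.hom_ext
    apply Submodule.linearMap_qext
    rfl
  map_comp φ ψ := by
    apply ModuleCat.hom_ext
    apply Submodule.linearMap_qext
    rfl

instance (a : Q) (S : Set Q) : (kernelQuotient k a S).Additive where
  map_add {M N φ ψ} := by
    apply ModuleCat.hom_ext
    apply Submodule.linearMap_qext
    rfl

/-- The functor sending a module to the common part, in its space at `a`, of the images of the
structure maps from the points of `S`. -/
def imageFunctor (k : Type v) [Field k] {Q : Type u} [PartialOrder Q] (a : Q) (S : Set Q) :
    PMod k Q ⥤ ModuleCat.{v} k where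
  obj M := ModuleCat.of k (imageInter M a S)
  map φ := ModuleCat.ofHom ((component φ a).restrict (component_mem_imageInter φ a S))

instance (a : Q) (S : Set Q) : (imageFunctor k a S).Additive where

open Classical in
/-- The generalized rank over a subset with a least element. -/
def leastRank (S : Set Q) (M : PMod k Q) : ℤ :=
  if h : ∃ a, IsLeast S a then Module.finrank k ((kernelQuotient k h.choose S).obj M) else 0

open Classical in
/-- The generalized rank over a subset with a greatest element. -/
def greatestRank (S : Set Q) (M : PMod k Q) : ℤ :=
  if h : ∃ a, IsGreatest S a then Module.finrank k ((imageFunctor k h.choose S).obj M) else 0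

theorem leastRank_eq {S : Set Q} {a : Q} (ha : IsLeast S a) (M : PMod k Q) :
    leastRank S M = Module.finrank k (M.obj a ⧸ kernelSum M a S) := by
  have h : ∃ a, IsLeast S a := ⟨a, ha⟩
  obtain rfl := h.choose_spec.unique ha
  exact dif_pos h

theorem greatestRank_eq {S : Set Q} {a : Q} (ha : IsGreatest S a) (M : PMod k Q) :
    greatestRank S M = Module.finrank k (imageInter M a S) := by
  have h : ∃ a, IsGreatest S a := ⟨a, ha⟩
  obtain rfl := h.choose_spec.unique ha
  exact dif_pos h

theorem isAdditiveInvariant_leastRank {S : Set Q} {a : Q} (ha : IsLeast S a) :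
    IsAdditiveInvariant (leastRank (k := k) S) := by
  rw [funext (leastRank_eq ha)]
  exact isAdditiveInvariant_finrank (kernelQuotient k a S)
    fun M => inferInstanceAs (Module.Finite k (M.obj a ⧸ kernelSum M a S))

theorem isAdditiveInvariant_greatestRank {S : Set Q} {a : Q} (ha : IsGreatest S a) :
    IsAdditiveInvariant (greatestRank (k := k) S) := by
  rw [funext (greatestRank_eq ha)]
  exact isAdditiveInvariant_finrank (imageFunctor k a S)
    fun M => inferInstanceAs (Module.Finite k (imageInter M a S))

open Classical in
-- If `S ⊆ T`, all structure maps from `a` to points of `S` are injective and nothing is divided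
-- out. Otherwise the map to a point of `S` outside `T` is zero, and its kernel is the whole space.
theorem leastRank_interval {S : Set Q} {a : Q} (ha : IsLeast S a) (T : Set Q) [T.OrdConnected] :
    leastRank S (intervalModule k T) = if S ⊆ T then 1 else 0 := by
  rw [leastRank_eq ha]
  split_ifs with h
  · have : kernelSum (intervalModule k T) a S = ⊥ := by
      refine le_bot_iff.1 (kernelSum_le fun b hab hb x hx => ?_)
      refine intervalCoord_injective T a ?_
      rw [← intervalCoord_act T hab (h hb), LinearMap.mem_ker.1 hx, map_zero, map_zero]
    rw [this, (Submodule.quotEquivOfEqBot _ rfl).finrank_eq, finrank_interval_of_mem (h ha.1)]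
    rfl
  · obtain ⟨b, hb, hbT⟩ := Set.not_subset.1 h
    have : kernelSum (intervalModule k T) a S = ⊤ := by
      refine top_le_iff.1 (le_trans (fun x _ => ?_) (ker_le_kernelSum _ (ha.2 hb) hb))
      rw [LinearMap.mem_ker]
      apply intervalCoord_injective T
      rw [intervalCoord_eq_zero T hbT, map_zero]
    have hs := Submodule.Quotient.subsingleton_iff.2 this
    rw [Module.finrank_zero_of_subsingleton]
    rfl

open Classical in
-- If `S ⊆ T`, all structure maps from points of `S` to `a` are surjective. Otherwise one of them
-- has zero source, and the intersection vanishes.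
theorem greatestRank_interval {S : Set Q} {a : Q} (ha : IsGreatest S a) (T : Set Q)
    [T.OrdConnected] : greatestRank S (intervalModule k T) = if S ⊆ T then 1 else 0 := by
  rw [greatestRank_eq ha]
  split_ifs with h
  · have : imageInter (intervalModule k T) a S = ⊤ := by
      refine top_le_iff.1 (le_imageInter fun b hab hb x _ => ?_)
      refine ⟨intervalElt T (h hb) (intervalCoord T a x), intervalCoord_injective T a ?_⟩
      rw [intervalCoord_act T hab (h ha.1), intervalCoord_intervalElt]
    rw [this, finrank_top, finrank_interval_of_mem (h ha.1)]
    rfl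
  · obtain ⟨b, hb, hbT⟩ := Set.not_subset.1 h
    have : imageInter (intervalModule k T) a S = ⊥ := by
      refine le_bot_iff.1 ((imageInter_le_range _ (ha.2 hb) hb).trans ?_)
      rintro _ ⟨x, rfl⟩
      have : x = 0 := intervalCoord_injective T b
        ((intervalCoord_eq_zero T hbT x).trans (map_zero _).symm)
      rw [this, map_zero]
      exact zero_mem _
    rw [this, finrank_bot]
    rfl

variable {X : Type w} [PartialOrder X]

/-- Each hull point lies below some `f t` with `t ∈ S`, and the kernel of the map to it is contained
in the kernel of the map to `f t`. So the extra points of the hull do not enlarge the sum of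
kernels. -/
theorem leastRank_restrict (f : X ↪o Q) {S : Set X} {a : X} (ha : IsLeast S a) (M : PMod k Q) :
    leastRank S ((restrict k f).obj M) = leastRank (hull f S) M := by
  rw [leastRank_eq ha, leastRank_eq (isLeast_hull f ha)]
  have : kernelSum ((restrict k f).obj M) a S = kernelSum M (f a) (hull f S) := by
    refine le_antisymm (kernelSum_le fun b h hb => ?_) (kernelSum_le fun p h hp => ?_)
    · exact ker_le_kernelSum M (f.monotone h) (map_mem_hull f hb)
    · obtain ⟨-, -, t, ht, -, hpt⟩ := hp
      have h1 : LinearMap.ker (act M (f.monotone (ha.2 ht))) ≤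
          kernelSum ((restrict k f).obj M) a S :=
        ker_le_kernelSum ((restrict k f).obj M) (ha.2 ht) ht
      refine le_trans (fun x hx => ?_) h1
      rw [LinearMap.mem_ker] at hx ⊢
      rw [← act_act M h hpt, hx, map_zero]
  rw [← this]
  rfl

/-- Each hull point lies above some `f s` with `s ∈ S`, and the image from it contains the image
from `f s`. So the extra points do not shrink the intersection. -/
theorem greatestRank_restrict (f : X ↪o Q) {S : Set X} {a : X} (ha : IsGreatest S a)
    (M : PMod k Q) :
    greatestRank S ((restrict k f).obj M) = greatestRank (hull f S) M := by
  rw [greatestRank_eq ha, greatestRank_eq (isGreatest_hull f ha)]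
  have h1 (b : X) (h : b ≤ a) (hb : b ∈ S) :
      imageInter ((restrict k f).obj M) a S ≤ LinearMap.range (act M (f.monotone h)) :=
    imageInter_le_range ((restrict k f).obj M) h hb
  have h2 : imageInter ((restrict k f).obj M) a S ≤ imageInter M (f a) (hull f S) := by
    refine le_imageInter (M := M) (a := f a) fun p h hp => ?_
    obtain ⟨s, hs, -, -, hsp, -⟩ := hp
    refine (h1 s (ha.2 hs) hs).trans ?_
    rintro _ ⟨y, rfl⟩
    exact ⟨act M hsp y, act_act M hsp h y⟩
  have h3 : imageInter M (f a) (hull f S) ≤ imageInter ((restrict k f).obj M) a S :=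
    le_imageInter (M := (restrict k f).obj M) (a := a) fun b h hb =>
      imageInter_le_range M (f.monotone h) (map_mem_hull f hb)
  have : imageInter ((restrict k f).obj M) a S = imageInter M (f a) (hull f S) :=
    le_antisymm h2 h3
  rw [← this]
  rfl

end Ranks

/-! ### Simple modules -/

section Simple

variable {k : Type v} [Field k] {Q : Type u} [PartialOrder Q]

theorem simple_interval_singleton (p : Q) : Simple (intervalModule k ({p} : Set Q)) where
  mono_isIso_iff_nonzero {Y} φ _ := by
    constructor
    · intro hφ h0
      refine not_isZero_interval (k := k) (Set.mem_singleton p) ((IsZero.iff_id_eq_zero _).2 ?_)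
      exact (IsIso.inv_hom_id φ).symm.trans ((congrArg (inv φ ≫ ·) h0).trans comp_zero)
    · intro h0
      obtain ⟨y, hy⟩ : ∃ y, component φ p y ≠ 0 := by
        by_contra! h
        refine h0 (hom_ext_component fun a x => ?_)
        by_cases ha : a = p
        · subst ha
          exact h x
        · apply intervalCoord_injective
          rw [intervalCoord_eq_zero ({p} : Set Q) ha, intervalCoord_eq_zero ({p} : Set Q) ha]
      have : Epi φ := ⟨fun {Z} χ ψ h => hom_ext_component fun a x => by
        by_cases ha : a = p
        · subst ha
          have hc : intervalCoord {a} a (component φ a y) ≠ 0 := fun h =>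
            hy (intervalCoord_injective _ a (h.trans (map_zero _).symm))
          have : x = component φ a ((intervalCoord {a} a x / intervalCoord {a} a
              (component φ a y)) • y) := by
            apply intervalCoord_injective
            rw [map_smul, map_smul, smul_eq_mul, div_mul_cancel₀ _ hc]
          rw [this, ← component_comp, h, component_comp]
        · have : x = 0 := intervalCoord_injective _ a
            ((intervalCoord_eq_zero ({p} : Set Q) ha x).trans (map_zero _).symm)
          rw [this, map_zero, map_zero]⟩
      exact isIso_of_mono_of_epi φ

/-- At a maximal point of the support of a simple module, a nonzero vector is killed by all proper
structure maps. It gives a nonzero morphism from a simple interval module, hence an isomorphism. -/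
theorem simple_iff_exists_iso_interval [Finite Q] (N : PMod k Q) :
    Simple N ↔ ∃ p : Q, Nonempty (N ≅ intervalModule k ({p} : Set Q)) := by
  constructor
  · intro hN
    have h0 : ∃ p, ∃ x : N.obj p, x ≠ 0 := by
      by_contra! h
      exact Simple.not_isZero N (isZero_iff_forall.2 h)
    obtain ⟨p, ⟨x, hx⟩, hp⟩ :=
      (Set.toFinite {p | ∃ x : N.obj p, x ≠ 0}).exists_maximal h0
    have hp' {q : Q} (hpq : p ≤ q) (hq : q ≠ p) (y : N.obj q) : y = 0 := by
      by_contra hy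
      exact hq (le_antisymm (hp ⟨y, hy⟩ hpq) hpq)
    classical
    -- The structure map along `p = a` serves only to transport `x` to the space at `a`.
    let v (a : Q) : N.obj a := if h : p = a then act N h.le x else 0
    have hvp : v p = x := (dif_pos rfl).trans (act_refl N x)
    have hv0 {a : Q} (ha : a ≠ p) : v a = 0 := by
      by_cases h : p ≤ a
      · exact hp' h ha _
      · exact dif_neg fun e => h e.le
    let φ : intervalModule k ({p} : Set Q) ⟶ N := homOfInterval {p} v
      (by
        rintro a b h rfl
        rcases eq_or_ne b a with rfl | hb
        · exact act_refl N _
        · rw [hp' h hb (v b)]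
          exact hp' h hb _) hv0
    have hφ : φ ≠ 0 := by
      intro h
      have h1 := congrArg (fun ψ => component ψ p (intervalElt {p} rfl (1 : k))) h
      change (1 : k) • v p = 0 at h1
      rw [one_smul, hvp] at h1
      exact hx h1
    have := simple_interval_singleton (k := k) p
    have := isIso_of_hom_simple hφ
    exact ⟨p, ⟨(asIso φ).symm⟩⟩
  · rintro ⟨p, ⟨e⟩⟩
    have := simple_interval_singleton (k := k) p
    exact Simple.of_iso e

end Simple

/-! ### Linear functionals -/

section Functionals

variable {k : Type v} [Field k] {V W : Type*} [AddCommGroup V] [Module k V] [AddCommGroup W]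
  [Module k W]

theorem exists_functional_of_notMem (K : Submodule k V) {v : V} (hv : v ∉ K) :
    ∃ φ : V →ₗ[k] k, (∀ x ∈ K, φ x = 0) ∧ φ v = 1 := by
  obtain ⟨φ, hφ, hK⟩ := Submodule.exists_le_ker_of_notMem hv
  refine ⟨(φ v)⁻¹ • φ, fun x hx => ?_, ?_⟩
  · rw [LinearMap.smul_apply, LinearMap.mem_ker.1 (hK hx), smul_zero]
  · rw [LinearMap.smul_apply, smul_eq_mul, inv_mul_cancel₀ hφ]

theorem exists_functional_of_ne_zero {v : V} (hv : v ≠ 0) : ∃ φ : V →ₗ[k] k, φ v = 1 :=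
  (exists_functional_of_notMem (⊥ : Submodule k V) hv).imp fun _ h => h.2

theorem exists_functional_comp_eq {f : V →ₗ[k] W} (hf : Function.Surjective f) {φ : V →ₗ[k] k}
    (h : ∀ x ∈ LinearMap.ker f, φ x = 0) : ∃ ψ : W →ₗ[k] k, ∀ x, ψ (f x) = φ x := by
  obtain ⟨s, hs⟩ := f.exists_rightInverse_of_surjective (LinearMap.range_eq_top.2 hf)
  refine ⟨φ ∘ₗ s, fun x => ?_⟩
  rw [LinearMap.comp_apply, ← sub_eq_zero, ← map_sub]
  refine h _ ?_
  rw [LinearMap.mem_ker, map_sub, ← LinearMap.comp_apply, hs, LinearMap.id_apply, sub_self]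

end Functionals

variable {k : Type v} [Field k]

/-! ### Modules over the poset with one source and two sinks -/

namespace XPrime

instance (S : Set XPrime) : S.OrdConnected where
  out' := by
    rintro x hx y hy z ⟨rfl | rfl, rfl | rfl⟩ <;> assumption

theorem one_le (x : XPrime) : one ≤ x := Or.inr rfl

theorem mem_leastSets_iff (S : Set XPrime) :
    S ∈ {S : Set XPrime | ∃ a, IsLeast S a} ↔
    (∃ a, S = {a}) ∨ (∃ a b, a < b ∧ S = {a, b}) ∨ S = Set.univ := by
  constructor
  · rintro ⟨a, ha⟩
    by_cases h1 : one ∈ S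
    · by_cases h2 : two ∈ S <;> by_cases h3 : three ∈ S
      · exact Or.inr (Or.inr (by ext x; cases x <;> simp [*]))
      · exact Or.inr (Or.inl ⟨one, two, ⟨by simp, rfl⟩, by ext x; cases x <;> simp [*]⟩)
      · exact Or.inr (Or.inl ⟨one, three, ⟨by simp, rfl⟩, by ext x; cases x <;> simp [*]⟩)
      · exact Or.inl ⟨one, by ext x; cases x <;> simp [*]⟩
    · refine Or.inl ⟨a, Set.eq_singleton_iff_unique_mem.2 ⟨ha.1, fun x hx => ?_⟩⟩
      rcases ha.2 hx with h | h
      · exact h.symm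
      · exact absurd (h ▸ ha.1) h1
  · rintro (⟨a, rfl⟩ | ⟨a, b, hab, rfl⟩ | rfl)
    · exact ⟨a, isLeast_singleton⟩
    · exact ⟨a, by simp, by simp [lowerBounds, hab.le]⟩
    · exact ⟨one, trivial, fun x _ => one_le x⟩

theorem hull_univ {P : Type u} [PartialOrder P] (f : XPrime ↪o P) :
    hull f Set.univ = Set.Icc (f one) (f two) ∪ Set.Icc (f one) (f three) := by
  ext p
  constructor
  · rintro ⟨s, -, t, -, h1, h2⟩
    have h := (f.monotone (one_le s)).trans h1
    cases t
    · exact Or.inl ⟨h, h2.trans (f.monotone (one_le _))⟩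
    · exact Or.inl ⟨h, h2⟩
    · exact Or.inr ⟨h, h2⟩
  · rintro (h | h)
    · exact ⟨one, trivial, two, trivial, h⟩
    · exact ⟨one, trivial, three, trivial, h⟩

theorem nonempty_retract {N : PMod k XPrime} (S : Set XPrime) (v₁ : N.obj one) (v₂ : N.obj two)
    (v₃ : N.obj three) (φ₁ : N.obj one →ₗ[k] k) (φ₂ : N.obj two →ₗ[k] k)
    (φ₃ : N.obj three →ₗ[k] k)
    (hv : one ∈ S → act N (one_le two) v₁ = v₂ ∧ act N (one_le three) v₁ = v₃)
    (hv0 : (one ∉ S → v₁ = 0) ∧ (two ∉ S → v₂ = 0) ∧ (three ∉ S → v₃ = 0))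
    (hφ₂ : two ∈ S → ∀ x, φ₂ (act N (one_le two) x) = φ₁ x)
    (hφ₃ : three ∈ S → ∀ x, φ₃ (act N (one_le three) x) = φ₁ x)
    (hφ0 : (one ∉ S → φ₁ = 0) ∧ (two ∉ S → φ₂ = 0) ∧ (three ∉ S → φ₃ = 0))
    (h1 : (one ∈ S → φ₁ v₁ = 1) ∧ (two ∈ S → φ₂ v₂ = 1) ∧ (three ∈ S → φ₃ v₃ = 1)) :
    Nonempty (Retract (intervalModule k S) N) := by
  refine nonempty_retract_interval S
    (fun | one => v₁ | two => v₂ | three => v₃) (fun | one => φ₁ | two => φ₂ | three => φ₃)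
    (fun {a b} h ha => ?_) (fun {a} ha => ?_) (fun {a b} h hb x => ?_) (fun {a} ha => ?_)
    (fun {a} ha => ?_)
  · obtain rfl | rfl := id h
    · exact act_refl N _
    · cases b
      exacts [act_refl N _, (hv ha).1, (hv ha).2]
  · cases a
    exacts [hv0.1 ha, hv0.2.1 ha, hv0.2.2 ha]
  · obtain rfl | rfl := id h
    · rw [act_refl]
    · cases b
      exacts [by rw [act_refl], hφ₂ hb x, hφ₃ hb x]
  · cases a
    exacts [hφ0.1 ha, hφ0.2.1 ha, hφ0.2.2 ha]
  · cases a
    exacts [h1.1 ha, h1.2.1 ha, h1.2.2 ha]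

/-- For two maps `f`, `g` with common source, a vector outside the image of `f` or of `g` splits off
a singleton. Once both are surjective, functionals vanishing on a kernel descend. A vector outside
`ker f + ker g` then splits off the whole poset, and one in a single kernel splits off a pair. If
none exists, `f` and `g` vanish, the module lives at `one`, and any nonzero vector works. -/
theorem exists_retract (N : PMod k XPrime) (hN : ¬IsZero N) :
    ∃ S : Set XPrime, (∃ a, IsLeast S a) ∧ ∃ _ : S.OrdConnected,
      Nonempty (Retract (intervalModule k S) N) := by
  let f := act N (one_le two)
  let g := act N (one_le three)
  have hpair (b : XPrime) : ∃ a, IsLeast ({one, b} : Set XPrime) a :=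
    ⟨one, by simp, fun x _ => one_le x⟩
  by_cases hf : Function.Surjective f
  swap
  · obtain ⟨w, hw⟩ := not_forall.1 hf
    obtain ⟨φ, hφ, h1⟩ := exists_functional_of_notMem (LinearMap.range f) hw
    exact ⟨{two}, ⟨two, isLeast_singleton⟩, inferInstance,
      nonempty_retract {two} 0 w 0 0 φ 0 (by simp) (by simp)
        (fun _ x => hφ _ ⟨x, rfl⟩) (by simp) (by simp) (by simpa)⟩
  by_cases hg : Function.Surjective g
  swap
  · obtain ⟨w, hw⟩ := not_forall.1 hg
    obtain ⟨φ, hφ, h1⟩ := exists_functional_of_notMem (LinearMap.range g) hw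
    exact ⟨{three}, ⟨three, isLeast_singleton⟩, inferInstance,
      nonempty_retract {three} 0 0 w 0 0 φ (by simp) (by simp) (by simp)
        (fun _ x => hφ _ ⟨x, rfl⟩) (by simp) (by simpa)⟩
  by_cases hK : ∀ v, v ∈ LinearMap.ker f ⊔ LinearMap.ker g
  swap
  · obtain ⟨v, hv⟩ := not_forall.1 hK
    obtain ⟨φ, hφ, h1⟩ := exists_functional_of_notMem _ hv
    obtain ⟨φ₂, h2⟩ := exists_functional_comp_eq hf fun x hx =>
      hφ x (Submodule.mem_sup_left hx)
    obtain ⟨φ₃, h3⟩ := exists_functional_comp_eq hg fun x hx =>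
      hφ x (Submodule.mem_sup_right hx)
    exact ⟨Set.univ, ⟨one, trivial, fun x _ => one_le x⟩, inferInstance,
      nonempty_retract Set.univ v (f v) (g v) φ φ₂ φ₃ (fun _ => ⟨rfl, rfl⟩) (by simp)
        (fun _ => h2) (fun _ => h3) (by simp) (by simp [h1, h2, h3])⟩
  by_cases hKL : LinearMap.ker f ≤ LinearMap.ker g
  swap
  · obtain ⟨v, hv, hv'⟩ := Set.not_subset.1 hKL
    obtain ⟨φ, hφ, h1⟩ := exists_functional_of_notMem _ hv'
    obtain ⟨φ₃, h3⟩ := exists_functional_comp_eq hg hφ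
    exact ⟨{one, three}, hpair three, inferInstance,
      nonempty_retract {one, three} v 0 (g v) φ 0 φ₃ (fun _ => ⟨hv, rfl⟩) (by simp) (by simp)
        (fun _ => h3) (by simp) (by simp [h1, h3])⟩
  by_cases hLK : LinearMap.ker g ≤ LinearMap.ker f
  swap
  · obtain ⟨v, hv, hv'⟩ := Set.not_subset.1 hLK
    obtain ⟨φ, hφ, h1⟩ := exists_functional_of_notMem _ hv'
    obtain ⟨φ₂, h2⟩ := exists_functional_comp_eq hf hφ
    exact ⟨{one, two}, hpair two, inferInstance,
      nonempty_retract {one, two} v (f v) 0 φ φ₂ 0 (fun _ => ⟨rfl, hv⟩) (by simp)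
        (fun _ => h2) (by simp) (by simp) (by simp [h1, h2])⟩
  -- The two kernels coincide and their sum is everything, so both maps are zero.
  have hf0 (v : N.obj one) : f v = 0 := (sup_le le_rfl hLK) (hK v)
  have hg0 (v : N.obj one) : g v = 0 := (sup_le hKL le_rfl) (hK v)
  by_cases h1 : ∀ v : N.obj one, v = 0
  · refine absurd (isZero_iff_forall.2 fun a x => ?_) hN
    cases a
    · exact h1 x
    · obtain ⟨v, rfl⟩ := hf x
      exact hf0 v
    · obtain ⟨v, rfl⟩ := hg x
      exact hg0 v
  · obtain ⟨v, hv⟩ := not_forall.1 h1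
    obtain ⟨φ, hφ⟩ := exists_functional_of_ne_zero (k := k) hv
    exact ⟨{one}, ⟨one, isLeast_singleton⟩, inferInstance,
      nonempty_retract {one} v 0 0 φ 0 0 (fun _ => ⟨hf0 v, hg0 v⟩) (by simp) (by simp) (by simp)
        (by simp) (by simpa)⟩

theorem isRankFamily :
    IsRankFamily (k := k) {S : Set XPrime | ∃ a, IsLeast S a} leastRank where
  ordConnected _ _ := inferInstance
  additive := fun _ ⟨_, ha⟩ => isAdditiveInvariant_leastRank ha
  interval := fun _ ⟨_, ha⟩ T _ => leastRank_interval ha T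
  indecomposable := fun _ ⟨_, ha⟩ _ => indecomposable_interval_of_isLeast ha
  exists_retract := exists_retract

end XPrime

/-! ### Modules over the poset with two sources and one sink -/

namespace XDoublePrime

instance (S : Set XDoublePrime) : S.OrdConnected where
  out' := by
    rintro x hx y hy z ⟨rfl | rfl, rfl | rfl⟩ <;> assumption

theorem le_three (x : XDoublePrime) : x ≤ three := Or.inr rfl

theorem mem_greatestSets_iff (S : Set XDoublePrime) :
    S ∈ {S : Set XDoublePrime | ∃ a, IsGreatest S a} ↔
    (∃ a, S = {a}) ∨ (∃ a b, a < b ∧ S = {a, b}) ∨ S = Set.univ := by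
  constructor
  · rintro ⟨a, ha⟩
    by_cases h3 : three ∈ S
    · by_cases h1 : one ∈ S <;> by_cases h2 : two ∈ S
      · exact Or.inr (Or.inr (by ext x; cases x <;> simp [*]))
      · exact Or.inr (Or.inl ⟨one, three, ⟨by simp, rfl⟩, by ext x; cases x <;> simp [*]⟩)
      · exact Or.inr (Or.inl ⟨two, three, ⟨by simp, rfl⟩, by ext x; cases x <;> simp [*]⟩)
      · exact Or.inl ⟨three, by ext x; cases x <;> simp [*]⟩
    · refine Or.inl ⟨a, Set.eq_singleton_iff_unique_mem.2 ⟨ha.1, fun x hx => ?_⟩⟩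
      rcases ha.2 hx with h | h
      · exact h
      · exact absurd (h ▸ ha.1) h3
  · rintro (⟨a, rfl⟩ | ⟨a, b, hab, rfl⟩ | rfl)
    · exact ⟨a, isGreatest_singleton⟩
    · exact ⟨b, by simp, by simp [upperBounds, hab.le]⟩
    · exact ⟨three, trivial, fun x _ => le_three x⟩

theorem hull_univ {P : Type u} [PartialOrder P] (f : XDoublePrime ↪o P) :
    hull f Set.univ = Set.Icc (f one) (f three) ∪ Set.Icc (f two) (f three) := by
  ext p
  constructor
  · rintro ⟨s, -, t, -, h1, h2⟩
    have h := h2.trans (f.monotone (le_three t))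
    cases s
    · exact Or.inl ⟨h1, h⟩
    · exact Or.inr ⟨h1, h⟩
    · exact Or.inl ⟨(f.monotone (le_three _)).trans h1, h⟩
  · rintro (h | h)
    · exact ⟨one, trivial, three, trivial, h⟩
    · exact ⟨two, trivial, three, trivial, h⟩

theorem nonempty_retract {N : PMod k XDoublePrime} (S : Set XDoublePrime) (v₁ : N.obj one)
    (v₂ : N.obj two) (v₃ : N.obj three) (φ₁ : N.obj one →ₗ[k] k) (φ₂ : N.obj two →ₗ[k] k)
    (φ₃ : N.obj three →ₗ[k] k)
    (hv₁ : one ∈ S → act N (le_three one) v₁ = v₃)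
    (hv₂ : two ∈ S → act N (le_three two) v₂ = v₃)
    (hv0 : (one ∉ S → v₁ = 0) ∧ (two ∉ S → v₂ = 0) ∧ (three ∉ S → v₃ = 0))
    (hφ : three ∈ S → (∀ x, φ₃ (act N (le_three one) x) = φ₁ x) ∧
      ∀ x, φ₃ (act N (le_three two) x) = φ₂ x)
    (hφ0 : (one ∉ S → φ₁ = 0) ∧ (two ∉ S → φ₂ = 0) ∧ (three ∉ S → φ₃ = 0))
    (h1 : (one ∈ S → φ₁ v₁ = 1) ∧ (two ∈ S → φ₂ v₂ = 1) ∧ (three ∈ S → φ₃ v₃ = 1)) :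
    Nonempty (Retract (intervalModule k S) N) := by
  refine nonempty_retract_interval S
    (fun | one => v₁ | two => v₂ | three => v₃) (fun | one => φ₁ | two => φ₂ | three => φ₃)
    (fun {a b} h ha => ?_) (fun {a} ha => ?_) (fun {a b} h hb x => ?_) (fun {a} ha => ?_)
    (fun {a} ha => ?_)
  · obtain rfl | rfl := id h
    · exact act_refl N _
    · cases a
      exacts [hv₁ ha, hv₂ ha, act_refl N _]
  · cases a
    exacts [hv0.1 ha, hv0.2.1 ha, hv0.2.2 ha]
  · obtain rfl | rfl := id h
    · rw [act_refl]
    · cases a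
      exacts [(hφ hb).1 x, (hφ hb).2 x, by rw [act_refl]]
  · cases a
    exacts [hφ0.1 ha, hφ0.2.1 ha, hφ0.2.2 ha]
  · cases a
    exacts [h1.1 ha, h1.2.1 ha, h1.2.2 ha]

/-- For two maps `f`, `g` with common target, a nonzero kernel vector splits off a singleton, and a
nonzero common value of `f` and `g` splits off the whole poset. Otherwise the images meet in zero,
and a nonzero value of one map, with a functional killing the image of the other, splits off a pair.
If both maps are zero and injective, the module lives at `three`. -/
theorem exists_retract (N : PMod k XDoublePrime) (hN : ¬IsZero N) :
    ∃ S : Set XDoublePrime, (∃ a, IsGreatest S a) ∧ ∃ _ : S.OrdConnected,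
      Nonempty (Retract (intervalModule k S) N) := by
  let f := act N (le_three one)
  let g := act N (le_three two)
  have hpair (b : XDoublePrime) : ∃ a, IsGreatest ({b, three} : Set XDoublePrime) a :=
    ⟨three, by simp, fun x _ => le_three x⟩
  by_cases hf : ∀ v, f v = 0 → v = 0
  swap
  · push Not at hf
    obtain ⟨v, hv, hv'⟩ := hf
    obtain ⟨φ, h1⟩ := exists_functional_of_ne_zero (k := k) hv'
    exact ⟨{one}, ⟨one, isGreatest_singleton⟩, inferInstance,
      nonempty_retract {one} v 0 0 φ 0 0 (fun _ => hv) (by simp) (by simp) (by simp) (by simp)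
        (by simpa)⟩
  by_cases hg : ∀ v, g v = 0 → v = 0
  swap
  · push Not at hg
    obtain ⟨v, hv, hv'⟩ := hg
    obtain ⟨φ, h1⟩ := exists_functional_of_ne_zero (k := k) hv'
    exact ⟨{two}, ⟨two, isGreatest_singleton⟩, inferInstance,
      nonempty_retract {two} 0 v 0 0 φ 0 (by simp) (fun _ => hv) (by simp) (by simp) (by simp)
        (by simpa)⟩
  by_cases hfg : ∀ v w, f v = g w → f v = 0
  swap
  · push Not at hfg
    obtain ⟨v, w, hvw, h0⟩ := hfg
    obtain ⟨φ, h1⟩ := exists_functional_of_ne_zero (k := k) h0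
    exact ⟨Set.univ, ⟨three, trivial, fun x _ => le_three x⟩, inferInstance,
      nonempty_retract Set.univ v w (f v) (φ ∘ₗ f) (φ ∘ₗ g) φ (fun _ => rfl)
        (fun _ => hvw.symm) (by simp) (fun _ => ⟨fun _ => rfl, fun _ => rfl⟩) (by simp)
        (by simp [← hvw, h1])⟩
  by_cases h1 : ∀ v, f v = 0
  swap
  · obtain ⟨v, hv⟩ := not_forall.1 h1
    have hv' : f v ∉ LinearMap.range g := fun ⟨w, hw⟩ => hv (hfg v w hw.symm)
    obtain ⟨φ, hφ, h⟩ := exists_functional_of_notMem _ hv'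
    exact ⟨{one, three}, hpair one, inferInstance,
      nonempty_retract {one, three} v 0 (f v) (φ ∘ₗ f) 0 φ (fun _ => rfl) (by simp) (by simp)
        (fun _ => ⟨fun _ => rfl, fun x => hφ _ ⟨x, rfl⟩⟩) (by simp) (by simp [h])⟩
  by_cases h2 : ∀ v, g v = 0
  swap
  · obtain ⟨v, hv⟩ := not_forall.1 h2
    have hv' : g v ∉ LinearMap.range f := fun ⟨w, hw⟩ => hv (hw.symm.trans (h1 w))
    obtain ⟨φ, hφ, h⟩ := exists_functional_of_notMem _ hv'
    exact ⟨{two, three}, hpair two, inferInstance,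
      nonempty_retract {two, three} 0 v (g v) 0 (φ ∘ₗ g) φ (by simp) (fun _ => rfl) (by simp)
        (fun _ => ⟨fun x => hφ _ ⟨x, rfl⟩, fun _ => rfl⟩) (by simp) (by simp [h])⟩
  by_cases h3 : ∀ v : N.obj three, v = 0
  · refine absurd (isZero_iff_forall.2 fun a x => ?_) hN
    cases a
    exacts [hf x (h1 x), hg x (h2 x), h3 x]
  · obtain ⟨v, hv⟩ := not_forall.1 h3
    obtain ⟨φ, hφ⟩ := exists_functional_of_ne_zero (k := k) hv
    have h1' (x) : φ (act N (le_three one) x) = 0 := (congrArg φ (h1 x)).trans (map_zero φ)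
    have h2' (x) : φ (act N (le_three two) x) = 0 := (congrArg φ (h2 x)).trans (map_zero φ)
    exact ⟨{three}, ⟨three, isGreatest_singleton⟩, inferInstance,
      nonempty_retract {three} 0 0 v 0 0 φ (by simp) (by simp) (by simp)
        (fun _ => ⟨h1', h2'⟩) (by simp) (by simpa)⟩

theorem isRankFamily :
    IsRankFamily (k := k) {S : Set XDoublePrime | ∃ a, IsGreatest S a} greatestRank where
  ordConnected _ _ := inferInstance
  additive := fun _ ⟨_, ha⟩ => isAdditiveInvariant_greatestRank ha
  interval := fun _ ⟨_, ha⟩ T _ => greatestRank_interval ha T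
  indecomposable := fun _ ⟨_, ha⟩ _ => indecomposable_interval_of_isGreatest ha
  exists_retract := exists_retract

end XDoublePrime

/-! ### Simple modules, rectangles and generalized rectangles -/

section Rectangles

variable {P : Type u} [PartialOrder P] {X : Type w} [PartialOrder X]

/-- If `p` were comparable to no other point, `{p}` would be closed under relations in both
directions, hence everything by connectedness. -/
theorem exists_lt_or_gt [CategoryTheory.IsConnected P] [Nontrivial P] (p : P) :
    ∃ q, p < q ∨ q < p := by
  by_contra! h
  obtain ⟨q, hq⟩ := exists_ne p
  refine hq (induct_on_objects ({p} : Set P) rfl (fun {a b} f => ?_) q)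
  have hab := leOfHom f
  constructor
  · rintro rfl
    exact (hab.eq_of_not_lt (h b).1).symm
  · rintro rfl
    exact hab.eq_of_not_lt (h a).2

theorem hull_singleton (f : X ↪o P) (a : X) : hull f {a} = {f a} := by
  ext p
  constructor
  · rintro ⟨s, rfl, t, rfl, h1, h2⟩
    exact le_antisymm h2 h1
  · rintro rfl
    exact map_mem_hull f rfl

theorem hull_pair (f : X ↪o P) {a b : X} (hab : a ≤ b) :
    hull f {a, b} = Set.Icc (f a) (f b) := by
  ext p
  constructor
  · rintro ⟨s, hs, t, ht, h1, h2⟩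
    refine ⟨le_trans ?_ h1, h2.trans ?_⟩
    · rcases hs with rfl | rfl
      exacts [le_rfl, f.monotone hab]
    · rcases ht with rfl | rfl
      exacts [f.monotone hab, le_rfl]
  · exact fun h => ⟨a, by simp, b, by simp, h⟩

theorem nonempty_iso_interval_congr {S T : Set P} [S.OrdConnected] [T.OrdConnected] (h : S = T)
    (N : PMod k P) : Nonempty (N ≅ intervalModule k S) ↔ Nonempty (N ≅ intervalModule k T) := by
  obtain ⟨e⟩ := intervalModule_congr (k := k) h
  exact ⟨fun ⟨e'⟩ => ⟨e' ≪≫ e⟩, fun ⟨e'⟩ => ⟨e' ≪≫ e.symm⟩⟩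

/-- Hulls of singletons, strict pairs and the whole of `X` are points, closed intervals and the
generalized rectangles. The covering hypothesis realizes every interval; it realizes every point
because each point is comparable to another one. -/
theorem exists_iso_hull_iff [Finite P] [CategoryTheory.IsConnected P] [Nontrivial P]
    {𝒮 : Set (Set X)}
    (h𝒮 : ∀ S, S ∈ 𝒮 ↔ (∃ a, S = {a}) ∨ (∃ a b, a < b ∧ S = {a, b}) ∨ S = Set.univ)
    {E : Set (X ↪o P)}
    (hE : ∀ a b : P, a < b → ∃ f ∈ E, a ∈ Set.range f ∧ b ∈ Set.range f) (N : PMod k P) :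
    (∃ f ∈ E, ∃ S ∈ 𝒮, Nonempty (N ≅ intervalModule k (hull f S))) ↔
      (Simple N ∨ (∃ a b : P, a < b ∧ Nonempty (N ≅ intervalModule k (Set.Icc a b))) ∨
        ∃ f ∈ E, Nonempty (N ≅ intervalModule k (hull f Set.univ))) := by
  rw [simple_iff_exists_iso_interval]
  have hcongr {S T : Set P} [S.OrdConnected] [T.OrdConnected] (h : S = T) :
      Nonempty (N ≅ intervalModule k S) → Nonempty (N ≅ intervalModule k T) :=
    (nonempty_iso_interval_congr h N).1
  constructor
  · rintro ⟨f, hf, S, hS, hN⟩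
    obtain ⟨a, rfl⟩ | ⟨a, b, hab, rfl⟩ | rfl := (h𝒮 S).1 hS
    · exact Or.inl ⟨f a, hcongr (hull_singleton f a) hN⟩
    · exact Or.inr (Or.inl ⟨f a, f b, f.strictMono hab, hcongr (hull_pair f hab.le) hN⟩)
    · exact Or.inr (Or.inr ⟨f, hf, hN⟩)
  · rintro (⟨p, hN⟩ | ⟨a, b, hab, hN⟩ | ⟨f, hf, hN⟩)
    · obtain ⟨f, hf, x, rfl⟩ : ∃ f ∈ E, p ∈ Set.range f := by
        obtain ⟨q, hq | hq⟩ := exists_lt_or_gt p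
        · obtain ⟨f, hf, h, -⟩ := hE _ _ hq
          exact ⟨f, hf, h⟩
        · obtain ⟨f, hf, -, h⟩ := hE _ _ hq
          exact ⟨f, hf, h⟩
      exact ⟨f, hf, {x}, (h𝒮 _).2 (Or.inl ⟨x, rfl⟩), hcongr (hull_singleton f x).symm hN⟩
    · obtain ⟨f, hf, ⟨x, rfl⟩, ⟨y, rfl⟩⟩ := hE a b hab
      have hxy : x < y := f.lt_iff_lt.1 hab
      exact ⟨f, hf, {x, y}, (h𝒮 _).2 (Or.inr (Or.inl ⟨x, y, hxy, rfl⟩)),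
        hcongr (hull_pair f hxy.le).symm hN⟩
    · exact ⟨f, hf, Set.univ, (h𝒮 _).2 (Or.inr (Or.inr rfl)), hN⟩

end Rectangles
end PosetRep

end


theorem mainTheorem1 (k : Type v) [Field k] (P : Type u) [PartialOrder P] [Finite P]
    [CategoryTheory.IsConnected P] :
    (∀ (E : Set (XPrime ↪o P)) (I : Set (PMod k XPrime)),
      IsEmbRepresentatives E → IsIndRepresentatives (PMod k XPrime) I →
      (∀ a b : P, a < b → ∃ f ∈ E, a ∈ Set.range f ∧ b ∈ Set.range f) →
        (∃ Ψ : K0sp (PMod k P) →+ (E × I → ℤ),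
          IsMultInvariant E I Ψ ∧ IsBasisOfInvariant Ψ (intermediateExtensions E I)) ∧
        (Nontrivial P → ∀ N : PMod k P,
          (∃ R ∈ intermediateExtensions E I, Nonempty (N ≅ R)) ↔
            (Simple N ∨
              (∃ a b : P, a < b ∧ Nonempty (N ≅ intervalModule k (Set.Icc a b))) ∨
              (∃ f ∈ E, Nonempty (N ≅ intervalModule k
                (Set.Icc (f .one) (f .two) ∪ Set.Icc (f .one) (f .three))))))) ∧
    (∀ (E : Set (XDoublePrime ↪o P)) (I : Set (PMod k XDoublePrime)),
      IsEmbRepresentatives E → IsIndRepresentatives (PMod k XDoublePrime) I →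
      (∀ a b : P, a < b → ∃ f ∈ E, a ∈ Set.range f ∧ b ∈ Set.range f) →
        (∃ Ψ : K0sp (PMod k P) →+ (E × I → ℤ),
          IsMultInvariant E I Ψ ∧ IsBasisOfInvariant Ψ (intermediateExtensions E I)) ∧
        (Nontrivial P → ∀ N : PMod k P,
          (∃ R ∈ intermediateExtensions E I, Nonempty (N ≅ R)) ↔
            (Simple N ∨
              (∃ a b : P, a < b ∧ Nonempty (N ≅ intervalModule k (Set.Icc a b))) ∨
              (∃ f ∈ E, Nonempty (N ≅ intervalModule k
                (Set.Icc (f .one) (f .three) ∪ Set.Icc (f .two) (f .three))))))) := by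
  refine ⟨fun E I _ hI hcover => ⟨?_, fun _ N => ?_⟩, fun E I _ hI hcover => ⟨?_, fun _ N => ?_⟩⟩
  · refine XPrime.isRankFamily.isBasisOfInvariant
      (fun f _ ⟨_, ha⟩ => indecomposable_interval_of_isLeast (isLeast_hull f ha))
      (fun f g S ⟨a, ha⟩ T ⟨b, hb⟩ h M => ?_) E I hI
    -- Both sides are the rank of `M` over the same hull.
    rw [leastRank_restrict f ha, leastRank_restrict g hb, h]
  · rw [XPrime.isRankFamily.exists_intermediateExtension_iff E I hI,
      exists_iso_hull_iff XPrime.mem_leastSets_iff hcover]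
    simp_rw [nonempty_iso_interval_congr (XPrime.hull_univ _)]
  · refine XDoublePrime.isRankFamily.isBasisOfInvariant
      (fun f _ ⟨_, ha⟩ => indecomposable_interval_of_isGreatest (isGreatest_hull f ha))
      (fun f g S ⟨a, ha⟩ T ⟨b, hb⟩ h M => ?_) E I hI
    rw [greatestRank_restrict f ha, greatestRank_restrict g hb, h]
  · rw [XDoublePrime.isRankFamily.exists_intermediateExtension_iff E I hI,
      exists_iso_hull_iff XDoublePrime.mem_greatestSets_iff hcover]
    simp_rw [nonempty_iso_interval_congr (XDoublePrime.hull_univ _)]
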